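/- All representations are over $\mathbb{C}$. Let $G$ be a finite group and $n$ a positive integer. Let $D(G)$ be the Drinfel'd double of $G$, i.e. the Hopf algebra with basis $e_g\bowtie h$ ($g,h\in G$), multiplication $(e_g\bowtie h)(e_{g'}\bowtie h')=\delta_{g,\,hg'h^{-1}}\,e_g\bowtie hh'$, unit $\sum_{g} e_g\bowtie 1$, comultiplication $\Delta(e_g\bowtie h)=\sum_{ab=g}(e_a\bowtie h)\otimes(e_b\bowtie h)$, counit $\varepsilon(e_g\bowtie h)=\delta_{g,1}$ and antipode $S(e_g\bowtie h)=e_{h^{-1}g^{-1}h}\bowtie h^{-1}$. Its normalized integral is $\Lambda=\frac1{|G|}\sum_{h\in G}e_1\bowtie h$. The $n$-th Frobenius–Schur indicator of an irreducible representation $V$ of $D(G)$ with character $\chi$ is $\nu_n(V)=\chi(\Lambda^{[n]})$, where $x^{[n]}=x_1x_2\cdots x_n$ is the $n$-th Sweedler power. The group $G$ is called an $FSZ_n$-group if $\nu_n(V)\in\mathbb{Z}$ for every irreducible representation $V$ of $D(G)$. For $u,g\in G$ put $G_n(u,g)=\{a\in G : (au^{-1})^n=a^n=g\}$, and let $C_G(u,g)$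 be the subgroup of elements commuting with both $u$ and $g$; for every integer $m$ it acts by conjugation on $G_n(u,g^m)$. The group $G$ is called an $FSZ^+_n$-group if for all commuting $u,g\in G$ and all integers $m$ with $\gcd(m,|G|)=1$, the $C_G(u,g)$-sets $G_n(u,g)$ and $G_n(u,g^m)$ afford isomorphic permutation modules over $\mathbb{C}$ for $C_G(u,g)$. Theorem. For every finite group $G$ and every positive integer $n$, the following are equivalent: (a) $G$ is an $FSZ^+_n$-group; (b) the centralizer of every nonidentity element of $G$ is an $FSZ_n$-group. -/

import Mathlib

universe u

noncomputable section

section HopfIndicators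

open scoped TensorProduct

/-- `Λ` is a normalized (two-sided) integral of the Hopf algebra `H`:
`h Λ = ε(h) Λ = Λ h` for all `h`, and `ε(Λ) = 1`. -/
def IsNormalizedIntegral {H : Type*} [Ring H] [HopfAlgebra ℂ H] (Λ : H) : Prop :=
  (∀ h : H, h * Λ = Coalgebra.counit (R := ℂ) h • Λ ∧ Λ * h = Coalgebra.counit (R := ℂ) h • Λ) ∧
    Coalgebra.counit (R := ℂ) Λ = (1 : ℂ)

theorem IsNormalizedIntegral.unique {H : Type*} [Ring H] [HopfAlgebra ℂ H] {Λ Λ' : H}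
    (h : IsNormalizedIntegral Λ) (h' : IsNormalizedIntegral Λ') : Λ = Λ' := by
  have h1 := (h.1 Λ').1
  have h2 := (h'.1 Λ).2
  rw [h'.2, one_smul] at h1
  rw [h.2, one_smul] at h2
  rw [← h1, h2]

/-- The Sweedler power `h ↦ h^[n] = h₁ h₂ ⋯ hₙ`, that is, the `n`-th power of the identity map in
the convolution algebra of linear endomorphisms of `H`. -/
def sweedlerPower (H : Type*) [Ring H] [HopfAlgebra ℂ H] (n : ℕ) : H →ₗ[ℂ] H :=
  ((WithConv.toConv (LinearMap.id : H →ₗ[ℂ] H)) ^ n).ofConv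

/-- For the normalized integral `Λ` of `H`, the `n`-th Frobenius-Schur indicator
`ν_n(V) = χ_V(Λ^[n])` of the `H`-module `V`. -/
def frobeniusSchurIndicator {H : Type*} [Ring H] [HopfAlgebra ℂ H] (Λ : H) (n : ℕ)
    (V : Type*) [AddCommGroup V] [Module ℂ V] [Module H V] [IsScalarTower ℂ H V] : ℂ :=
  LinearMap.trace ℂ V (Algebra.lsmul ℂ ℂ V (sweedlerPower H n Λ))

end HopfIndicators

/-- The underlying vector space of the Drinfel'd double `D(G) = ℂ^G ⋈ ℂG`. -/
def DrinfeldDouble (G : Type u) : Type u := (G × G) →₀ ℂ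

namespace DrinfeldDouble

open scoped TensorProduct

attribute [local instance] Fintype.ofFinite

open scoped Classical

instance (G : Type u) : AddCommGroup (DrinfeldDouble G) :=
  inferInstanceAs (AddCommGroup ((G × G) →₀ ℂ))

instance (G : Type u) : Module ℂ (DrinfeldDouble G) :=
  inferInstanceAs (Module ℂ ((G × G) →₀ ℂ))

/-- The basis vector `e_g ⋈ h`, where `e_g` is the indicator function of `g`. -/
def bas {G : Type u} (g h : G) : DrinfeldDouble G := Finsupp.single (g, h) (1 : ℂ)

/-- The linear map with prescribed values on the basis `e_g ⋈ h`. -/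
def lift {G : Type u} {M : Type*} [AddCommGroup M] [Module ℂ M] (f : G → G → M) :
    DrinfeldDouble G →ₗ[ℂ] M :=
  Finsupp.linearCombination ℂ (fun p : G × G => f p.1 p.2)

@[simp]
theorem lift_bas {G : Type u} {M : Type*} [AddCommGroup M] [Module ℂ M] (f : G → G → M)
    (g h : G) : lift f (bas g h) = f g h := by
  change Finsupp.linearCombination ℂ (fun p : G × G => f p.1 p.2) (Finsupp.single (g, h) 1) = _
  rw [Finsupp.linearCombination_single, one_smul]

theorem hom_ext {G : Type u} {M : Type*} [AddCommMonoid M] [Module ℂ M]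
    {f f' : DrinfeldDouble G →ₗ[ℂ] M} (h : ∀ a b, f (bas a b) = f' (bas a b)) : f = f' :=
  Finsupp.lhom_ext' (M := ℂ) (fun p => LinearMap.ext_ring (h p.1 p.2))

/-- The multiplication `(e_g ⋈ h)(e_g' ⋈ h') = δ_{g, h g' h⁻¹} e_g ⋈ hh'`. -/
def mulL (G : Type u) [Group G] :
    DrinfeldDouble G →ₗ[ℂ] DrinfeldDouble G →ₗ[ℂ] DrinfeldDouble G :=
  lift fun g h => lift fun g' h' => if g = h * g' * h⁻¹ then bas g (h * h') else 0

instance (G : Type u) [Group G] : Mul (DrinfeldDouble G) := ⟨fun x y => mulL G x y⟩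

theorem bas_mul_bas {G : Type u} [Group G] (g h g' h' : G) :
    (bas g h * bas g' h' : DrinfeldDouble G) =
      if g = h * g' * h⁻¹ then bas g (h * h') else 0 := by
  change mulL G (bas g h) (bas g' h') = _
  simp [mulL]

/-- The unit is `∑ g, e_g ⋈ 1`. -/
instance (G : Type u) [Group G] [Finite G] : One (DrinfeldDouble G) := ⟨∑ g : G, bas g 1⟩

theorem one_eq {G : Type u} [Group G] [Finite G] :
    (1 : DrinfeldDouble G) = ∑ g : G, bas g 1 := rfl

theorem mulL_assoc {G : Type u} [Group G] (x y z : DrinfeldDouble G) :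
    mulL G (mulL G x y) z = mulL G x (mulL G y z) := by
  have : (mulL G).compr₂ (mulL G) =
      (LinearMap.llcomp ℂ (DrinfeldDouble G) (DrinfeldDouble G) (DrinfeldDouble G) ∘ₗ
        mulL G).compl₂ (mulL G) := by
    refine hom_ext fun a b => hom_ext fun c d => hom_ext fun e f => ?_
    simp only [LinearMap.compr₂_apply, LinearMap.compl₂_apply, LinearMap.comp_apply,
      LinearMap.llcomp_apply]
    simp only [mulL, lift_bas]
    by_cases h1 : a = b * c * b⁻¹ <;> by_cases h2 : c = d * e * d⁻¹
    · subst h2; subst h1; simp [mul_assoc]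
    · have : ¬ (a = b * d * e * (b * d)⁻¹) := by
        subst h1
        intro h
        apply h2
        have := congrArg (fun t => b⁻¹ * t * b) h
        simpa [mul_assoc] using this
      rw [if_pos h1, if_neg h2, lift_bas, lift_bas, if_neg this, map_zero]
    · rw [if_neg h1, if_pos h2, lift_bas, if_neg h1, map_zero, LinearMap.zero_apply]
    · rw [if_neg h1, if_neg h2, map_zero, map_zero, LinearMap.zero_apply]
  exact congr($this x y z)

theorem mulL_one_left {G : Type u} [Group G] [Finite G] (x : DrinfeldDouble G) :
    mulL G 1 x = x := by
  have : mulL G 1 = LinearMap.id := by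
    refine hom_ext fun a b => ?_
    simp [one_eq, mulL]
  exact congr($this x)

theorem mulL_one_right {G : Type u} [Group G] [Finite G] (x : DrinfeldDouble G) :
    mulL G x 1 = x := by
  have : (mulL G).flip 1 = LinearMap.id := by
    refine hom_ext fun a b => ?_
    have key : ∀ g : G, (a = b * g * b⁻¹) = (g = b⁻¹ * a * b) := by
      intro g
      refine propext ⟨fun h => ?_, fun h => ?_⟩ <;> subst h <;> simp [mul_assoc]
    simp [one_eq, mulL, key]
  exact congr($this x)

instance (G : Type u) [Group G] [Finite G] : Ring (DrinfeldDouble G) where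
  left_distrib x y z := map_add (mulL G x) y z
  right_distrib x y z := congr($(map_add (mulL G) x y) z)
  zero_mul x := congr($(map_zero (mulL G)) x)
  mul_zero x := map_zero (mulL G x)
  mul_assoc := mulL_assoc
  one_mul := mulL_one_left
  mul_one := mulL_one_right
  neg_add_cancel := neg_add_cancel
  zsmul := (· • ·)
  zsmul_zero' := SubNegMonoid.zsmul_zero'
  zsmul_succ' := SubNegMonoid.zsmul_succ'
  zsmul_neg' := SubNegMonoid.zsmul_neg'
  nsmul := (· • ·)
  nsmul_zero := AddMonoid.nsmul_zero
  nsmul_succ := AddMonoid.nsmul_succ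
  sub_eq_add_neg := sub_eq_add_neg

instance (G : Type u) [Group G] [Finite G] : Algebra ℂ (DrinfeldDouble G) :=
  Algebra.ofModule (fun r x y => congr($(map_smul (mulL G) r x) y))
    (fun r x y => map_smul (mulL G x) r y)

/-- `Δ(e_g ⋈ h) = ∑_{ab = g} (e_a ⋈ h) ⊗ (e_b ⋈ h)` and `ε(e_g ⋈ h) = δ_{g, 1}`. -/
instance (G : Type u) [Group G] [Finite G] : CoalgebraStruct ℂ (DrinfeldDouble G) where
  comul := lift fun g h => ∑ a : G, bas a h ⊗ₜ[ℂ] bas (a⁻¹ * g) h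
  counit := lift fun g _ => if g = 1 then 1 else 0

theorem comul_bas {G : Type u} [Group G] [Finite G] (g h : G) :
    Coalgebra.comul (R := ℂ) (bas g h) = ∑ a : G, bas a h ⊗ₜ[ℂ] bas (a⁻¹ * g) h :=
  lift_bas _ g h

theorem counit_bas {G : Type u} [Group G] [Finite G] (g h : G) :
    Coalgebra.counit (R := ℂ) (bas g h) = if g = 1 then (1 : ℂ) else 0 :=
  lift_bas _ g h

instance (G : Type u) [Group G] [Finite G] : Coalgebra ℂ (DrinfeldDouble G) where
  coassoc := by
    refine hom_ext fun g h => ?_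
    simp only [LinearMap.comp_apply, comul_bas, map_sum, LinearMap.rTensor_tmul,
      LinearMap.lTensor_tmul, TensorProduct.sum_tmul, TensorProduct.tmul_sum,
      LinearEquiv.coe_coe, TensorProduct.assoc_tmul]
    rw [Finset.sum_comm]
    refine Finset.sum_congr rfl fun a _ => ?_
    refine Fintype.sum_equiv (Equiv.mulLeft a⁻¹) _ _ fun b => ?_
    simp [mul_assoc]
  rTensor_counit_comp_comul := by
    refine hom_ext fun g h => ?_
    simp [comul_bas, counit_bas, TensorProduct.ite_tmul]
  lTensor_counit_comp_comul := by
    refine hom_ext fun g h => ?_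
    simp [comul_bas, counit_bas, TensorProduct.tmul_ite, inv_mul_eq_one]

theorem counit_mul' {G : Type u} [Group G] [Finite G] (x y : DrinfeldDouble G) :
    Coalgebra.counit (R := ℂ) (x * y) =
      Coalgebra.counit (R := ℂ) x * Coalgebra.counit (R := ℂ) y := by
  have : (LinearMap.mul ℂ (DrinfeldDouble G)).compr₂ (Coalgebra.counit (R := ℂ)) =
      (LinearMap.mul ℂ ℂ).compl₁₂ (Coalgebra.counit (R := ℂ)) (Coalgebra.counit (R := ℂ)) := by
    refine hom_ext fun a b => hom_ext fun c d => ?_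
    simp only [LinearMap.compr₂_apply, LinearMap.compl₁₂_apply, LinearMap.mul_apply',
      bas_mul_bas, counit_bas]
    by_cases hc : c = 1
    · subst hc
      by_cases ha : a = 1 <;> simp [ha, counit_bas]
    · by_cases ha : a = 1
      · have : ¬ (1 = b * c * b⁻¹) := by
          intro h
          apply hc
          have := congrArg (fun t => b⁻¹ * t * b) h
          simpa [mul_assoc] using this.symm
        simp [hc, ha, this]
      · by_cases h : a = b * c * b⁻¹
        · rw [if_pos h, counit_bas]; simp [ha]
        · rw [if_neg h]; simp [ha]
  exact congr($this x y)

theorem comul_mul' {G : Type u} [Group G] [Finite G] (x y : DrinfeldDouble G) :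
    Coalgebra.comul (R := ℂ) (x * y) =
      Coalgebra.comul (R := ℂ) x * Coalgebra.comul (R := ℂ) y := by
  have : (LinearMap.mul ℂ (DrinfeldDouble G)).compr₂ (Coalgebra.comul (R := ℂ)) =
      (LinearMap.mul ℂ (DrinfeldDouble G ⊗[ℂ] DrinfeldDouble G)).compl₁₂
        (Coalgebra.comul (R := ℂ)) (Coalgebra.comul (R := ℂ)) := by
    refine hom_ext fun a b => hom_ext fun c d => ?_
    have key : ∀ s t : G, (s = b * t * b⁻¹) = (t = b⁻¹ * s * b) := by
      intro s t
      refine propext ⟨fun h => ?_, fun h => ?_⟩ <;> subst h <;> simp [mul_assoc]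
    simp only [LinearMap.compr₂_apply, LinearMap.compl₁₂_apply, LinearMap.mul_apply',
      bas_mul_bas, comul_bas, Finset.sum_mul_sum, Algebra.TensorProduct.tmul_mul_tmul, key,
      TensorProduct.ite_tmul, Finset.sum_ite_eq', Finset.mem_univ, if_true]
    by_cases h : c = b⁻¹ * a * b
    · subst h
      simp [comul_bas, mul_assoc]
    · have h' : ∀ s : G, ¬ ((b⁻¹ * s * b)⁻¹ * c = b⁻¹ * (s⁻¹ * a) * b) := by
        intro s hs
        apply h
        have := congrArg (fun t => (b⁻¹ * s * b) * t) hs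
        simpa [mul_assoc] using this
      simp only [if_neg h, if_neg (h' _), map_zero, TensorProduct.tmul_zero,
        Finset.sum_const_zero]
  exact congr($this x y)

instance (G : Type u) [Group G] [Finite G] : Bialgebra ℂ (DrinfeldDouble G) :=
  Bialgebra.mk' ℂ (DrinfeldDouble G)
    (by simp [one_eq, counit_bas])
    (counit_mul' _ _)
    (by
      simp only [one_eq, map_sum, comul_bas, Algebra.TensorProduct.one_def,
        TensorProduct.sum_tmul, TensorProduct.tmul_sum]
      conv_lhs => rw [Finset.sum_comm]
      conv_rhs => rw [Finset.sum_comm]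
      refine Finset.sum_congr rfl fun a _ => ?_
      exact Fintype.sum_equiv (Equiv.mulLeft a⁻¹) _ _ fun b => rfl)
    (comul_mul' _ _)

/-- The antipode `S(e_g ⋈ h) = e_{h⁻¹ g⁻¹ h} ⋈ h⁻¹`. -/
instance (G : Type u) [Group G] [Finite G] : HopfAlgebra ℂ (DrinfeldDouble G) where
  antipode := lift fun g h => bas (h⁻¹ * g⁻¹ * h) h⁻¹
  mul_antipode_rTensor_comul := by
    refine hom_ext fun g h => ?_
    simp only [LinearMap.comp_apply, comul_bas, counit_bas, map_sum, LinearMap.rTensor_tmul,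
      lift_bas, LinearMap.mul'_apply, bas_mul_bas, Algebra.linearMap_apply]
    have key : ∀ a : G, (h⁻¹ * a⁻¹ * h = h⁻¹ * (a⁻¹ * g) * h⁻¹⁻¹) = (g = 1) := by
      intro a
      simp [mul_assoc]
    simp only [key]
    by_cases hg : g = 1
    · simp only [hg, if_true, map_one, one_eq, inv_mul_cancel]
      refine Fintype.sum_equiv
        ((Equiv.inv G).trans ((Equiv.mulLeft h⁻¹).trans (Equiv.mulRight h))) _ _ fun b => ?_
      simp
    · simp [hg]
  mul_antipode_lTensor_comul := by
    refine hom_ext fun g h => ?_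
    simp only [LinearMap.comp_apply, comul_bas, counit_bas, map_sum, LinearMap.lTensor_tmul,
      lift_bas, LinearMap.mul'_apply, bas_mul_bas, Algebra.linearMap_apply]
    have key : ∀ a : G, (a = h * (h⁻¹ * (a⁻¹ * g)⁻¹ * h) * h⁻¹) = (g = 1) := by
      intro a
      refine propext ⟨fun h1 => ?_, fun h1 => ?_⟩
      · have := congrArg (fun t => g * t * a⁻¹) h1
        simpa [mul_assoc] using this
      · subst h1; simp [mul_assoc]
    simp only [key]
    by_cases hg : g = 1
    · simp [hg, one_eq]
    · simp [hg]

/-- The normalized integral `|G|⁻¹ ∑ h, e_1 ⋈ h` of `D(G)`. -/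
def integral (G : Type u) [Group G] [Finite G] : DrinfeldDouble G :=
  (Nat.card G : ℂ)⁻¹ • ∑ h : G, bas 1 h

theorem isNormalizedIntegral_integral (G : Type u) [Group G] [Finite G] :
    IsNormalizedIntegral (integral G) := by
  refine ⟨fun x => ⟨?_, ?_⟩, ?_⟩
  · have : (LinearMap.mul ℂ (DrinfeldDouble G)).flip (integral G) =
        (Coalgebra.counit (R := ℂ) (A := DrinfeldDouble G)).smulRight (integral G) := by
      refine hom_ext fun a b => ?_
      simp only [LinearMap.flip_apply, LinearMap.mul_apply', LinearMap.smulRight_apply,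
        counit_bas, integral, mul_smul_comm, Finset.mul_sum, bas_mul_bas, mul_one,
        mul_inv_cancel]
      by_cases ha : a = 1
      · simp only [ha, if_true, one_smul]
        congr 1
        exact Fintype.sum_equiv (Equiv.mulLeft b) _ _ fun _ => rfl
      · simp [ha]
    exact congr($this x)
  · have : LinearMap.mul ℂ (DrinfeldDouble G) (integral G) =
        (Coalgebra.counit (R := ℂ) (A := DrinfeldDouble G)).smulRight (integral G) := by
      refine hom_ext fun a b => ?_
      have key : ∀ s : G, (1 = s * a * s⁻¹) = (a = 1) := by
        intro s
        refine propext ⟨fun h => ?_, fun h => by simp [h]⟩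
        have := congrArg (fun t => s⁻¹ * t * s) h
        simpa [mul_assoc] using this.symm
      simp only [LinearMap.mul_apply', LinearMap.smulRight_apply,
        counit_bas, integral, smul_mul_assoc, Finset.sum_mul, bas_mul_bas, key]
      by_cases ha : a = 1
      · simp only [ha, if_true, one_smul]
        congr 1
        exact Fintype.sum_equiv (Equiv.mulRight b) _ _ fun _ => rfl
      · simp [ha]
    exact congr($this x)
  · have : (Nat.card G : ℂ) ≠ 0 := Nat.cast_ne_zero.mpr Nat.card_pos.ne'
    simp only [integral, map_smul, map_sum, counit_bas, if_true, Finset.sum_const,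
      Finset.card_univ, nsmul_eq_mul, mul_one, smul_eq_mul]
    rw [← Nat.card_eq_fintype_card]
    exact inv_mul_cancel₀ this

end DrinfeldDouble

/-- `G` is an `FSZ_n`-group: the `n`-th Frobenius-Schur indicator of every irreducible
representation of `D(G)` is an integer. (Simple `D(G)`-modules are quotients of `D(G)`, hence
finite-dimensional and representable in the universe of `G`.) -/
def IsFSZ (n : ℕ) (G : Type u) [Group G] [Finite G] : Prop :=
  ∀ (V : Type u) [AddCommGroup V] [Module ℂ V] [Module (DrinfeldDouble G) V]
    [IsScalarTower ℂ (DrinfeldDouble G) V] [IsSimpleModule (DrinfeldDouble G) V],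
    ∃ k : ℤ, frobeniusSchurIndicator (DrinfeldDouble.integral G) n V = (k : ℂ)

section FSZPlus

/-- The set `G_n(u, g)` of all `a` with `(a u⁻¹)ⁿ = aⁿ = g`. -/
def rootSet {G : Type u} [Group G] (n : ℕ) (u g : G) : Set G :=
  {a | (a * u⁻¹) ^ n = a ^ n ∧ a ^ n = g}

theorem conj_mem_rootSet {G : Type u} [Group G] {n : ℕ} {u g g' k a : G}
    (hk : k ∈ Subgroup.centralizer {u, g}) (hg' : g' ∈ Subgroup.zpowers g)
    (ha : a ∈ rootSet n u g') : k * a * k⁻¹ ∈ rootSet n u g' := by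
  have hku : k * u⁻¹ * k⁻¹ = u⁻¹ := by
    have h : Commute u k := (Subgroup.mem_centralizer_iff.mp hk) u (by simp)
    rw [(h.symm.inv_right).eq, mul_inv_cancel_right]
  have hkg : k * g' * k⁻¹ = g' := by
    have h : Commute g k := (Subgroup.mem_centralizer_iff.mp hk) g (by simp)
    obtain ⟨z, rfl⟩ := Subgroup.mem_zpowers_iff.mp hg'
    rw [(h.symm.zpow_right z).eq, mul_inv_cancel_right]
  obtain ⟨h1, h2⟩ := ha
  have h3 : k * a * k⁻¹ * u⁻¹ = k * (a * u⁻¹) * k⁻¹ := by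
    conv_lhs => rw [← hku]
    simp [mul_assoc]
  refine ⟨?_, ?_⟩
  · rw [h3, conj_pow, conj_pow, h1]
  · rw [conj_pow, h2, hkg]

/-- For `g'` a power of `g`, the group `C_G(u, g)` acts on `G_n(u, g')` by conjugation. -/
@[reducible]
def conjAction {G : Type u} [Group G] (n : ℕ) (u g : G) {g' : G}
    (hg' : g' ∈ Subgroup.zpowers g) :
    MulAction (Subgroup.centralizer {u, g}) (rootSet n u g') where
  smul k a := ⟨(k : G) * a * (k : G)⁻¹, conj_mem_rootSet k.2 hg' a.2⟩
  one_smul a := Subtype.ext (by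
    change (1 : G) * a * (1 : G)⁻¹ = a
    simp)
  mul_smul k l a := Subtype.ext (by
    change ((k : G) * l) * a * ((k : G) * l)⁻¹ = k * (l * a * (l : G)⁻¹) * (k : G)⁻¹
    simp [mul_assoc])

/-- For `g'` a power of `g`, the permutation module over `ℂ` of `C_G(u, g)` afforded by
`G_n(u, g')`. -/
def permRep {G : Type u} [Group G] (n : ℕ) (u g : G) {g' : G}
    (hg' : g' ∈ Subgroup.zpowers g) :
    Representation ℂ (Subgroup.centralizer {u, g}) (MonoidAlgebra ℂ (rootSet n u g')) :=
  letI := conjAction n u g hg'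
  Representation.ofMulAction ℂ (Subgroup.centralizer {u, g}) (rootSet n u g')

/-- `G` is an `FSZ⁺_n`-group: for all commuting `u, g` and all integers `m` coprime to `|G|`, the
sets `G_n(u, g)` and `G_n(u, g ^ m)` afford isomorphic permutation modules for `C_G(u, g)`. -/
def IsFSZPlus (n : ℕ) (G : Type u) [Group G] [Finite G] : Prop :=
  ∀ u g : G, Commute u g → ∀ m : ℤ, Int.gcd m (Nat.card G) = 1 →
    Nonempty ((permRep n u g (Subgroup.mem_zpowers g)).Equiv
      (permRep n u g (Subgroup.zpow_mem_zpowers g m)))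

end FSZPlus

end

/-! Both conditions reduce to counting. The coefficient of e_u ⋈ g in |G| Λ^[n] is |G_n(u, g⁻¹)|,
and G is FSZ_n exactly when these numbers are invariant under g ↦ g^m for m coprime to |G|
(`isFSZ_iff_rootCount`, `isFSZ_iff_ncard_rootSet`). Indeed, for commuting u, g the number χ(e_u ⋈ g)
is a sum of |G|-th roots of unity, and the Galois automorphism ζ ↦ ζ^m carries it to χ(e_u ⋈ g^m).
So all indicators are rational if and only if certain central elements of D(G) agree under all
irreducible characters, hence agree. Rational indicators are integers because ν_n(V) is an algebraic
integer: it is the trace of the cyclic shift on the D(G)-invariants of the n-th tensor power of V.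

On the other side, complex permutation modules are determined by the numbers of fixed points, and
the fixed points of x on G_n(u, g) are the set G_n(u, g) formed inside C_G(x). Thus FSZ⁺_n is the
counting condition for all centralizers C_G(x), x = 1 included; coprimality to |G| or to |C_G(x)|
makes no difference, since units lift along ℤ/|G| → ℤ/|C_G(x)|. The case x = 1 is redundant: each a
in G_n(u, g) commutes with a^n = g, so g^m fixes all of G_n(u, g) and of G_n(u, g^m), and g^m ≠ 1
unless g = 1. -/

/-! ### Galois conjugation of traces of periodic operators. -/

section PeriodicTraces

open Polynomial

/-- If an integral polynomial takes an integral value at a primitive `N`-th root of unity, it takes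
the same value at all the others. -/
theorem IsPrimitiveRoot.aeval_pow_eq_of_aeval_eq_intCast {N : ℕ} (hN : 0 < N) {ζ : ℂ}
    (hζ : IsPrimitiveRoot ζ N) {Q : ℤ[X]} {k : ℤ} (hk : aeval ζ Q = (k : ℂ)) {m : ℕ}
    (hm : m.Coprime N) : aeval (ζ ^ m) Q = (k : ℂ) := by
  have h0 : aeval ζ (Q - C k) = 0 := by simp [hk]
  have h1 : minpoly ℤ ζ ∣ Q - C k :=
    minpoly.isIntegrallyClosed_dvd (hζ.isIntegral hN) h0
  rw [hζ.minpoly_eq_pow_coprime hm] at h1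
  obtain ⟨r, hr⟩ := h1
  have h2 : aeval (ζ ^ m) (Q - C k) = 0 := by rw [hr, map_mul, minpoly.aeval, zero_mul]
  simpa [sub_eq_zero] using h2

/-- An integral polynomial that is constant on the primitive `N`-th roots of unity takes an
integral value there. -/
theorem IsPrimitiveRoot.exists_intCast_eq_of_forall_aeval_pow_eq {N : ℕ} (hN : 0 < N) {ζ : ℂ}
    (hζ : IsPrimitiveRoot ζ N) {Q : ℤ[X]} {c : ℂ}
    (hc : ∀ m : ℕ, m.Coprime N → aeval (ζ ^ m) Q = c) : ∃ k : ℤ, c = k := by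
  -- The remainder has degree below φ(N) and equals c at φ(N) points, so it is the constant c, while
  -- its coefficients are integers.
  set r := Q %ₘ cyclotomic N ℤ with hr
  have hmon := cyclotomic.monic N ℤ
  have hval : ∀ μ ∈ primitiveRoots N ℂ, aeval μ r = c := by
    intro μ hμ
    have hμ' := (mem_primitiveRoots hN).1 hμ
    obtain ⟨m, -, hm, rfl⟩ := (haveI : NeZero N := ⟨hN.ne'⟩; hζ.isPrimitiveRoot_iff.1 hμ')
    rw [← hc m hm]
    have h0 : aeval (ζ ^ m) (cyclotomic N ℤ) = 0 := by
      have := hμ'.isRoot_cyclotomic hN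
      rwa [IsRoot.def, ← map_cyclotomic_int, ← algebraMap_int_eq,
        eval_map_algebraMap] at this
    conv_rhs => rw [← modByMonic_add_div Q (cyclotomic N ℤ)]
    simp [hr, h0]
  have hpoly : r.map (Int.castRingHom ℂ) = C c := by
    refine eq_of_degree_sub_lt_of_eval_finset_eq (primitiveRoots N ℂ) ?_ ?_
    · rw [hζ.card_primitiveRoots]
      have h1 : (r.map (Int.castRingHom ℂ)).degree < (N.totient : ℕ) := by
        refine degree_map_le.trans_lt ?_
        rw [← degree_cyclotomic N ℤ]
        exact degree_modByMonic_lt Q hmon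
      have h2 : (C c : ℂ[X]).degree < (N.totient : ℕ) :=
        degree_C_le.trans_lt (by exact_mod_cast Nat.totient_pos.2 hN)
      exact (degree_sub_le _ _).trans_lt (max_lt h1 h2)
    · intro μ hμ
      rw [eval_C, ← hval μ hμ]
      exact eval_map_algebraMap r μ
  refine ⟨r.coeff 0, ?_⟩
  have := congrArg (fun p : ℂ[X] => p.coeff 0) hpoly
  simpa using this.symm

/-- `A` is killed by X(X^N - 1), which has no repeated root. Allowing the eigenvalue 0 matters: the
basis elements of D(G) and the operator P * S used below need not be invertible. -/
theorem Module.End.isSemisimple_of_pow_succ_eq_self {V : Type*} [AddCommGroup V] [Module ℂ V]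
    {N : ℕ} (hN : 0 < N) {A : Module.End ℂ V} (hA : A ^ (N + 1) = A) :
    A.IsSemisimple := by
  refine Module.End.isSemisimple_of_squarefree_aeval_eq_zero (p := X * (X ^ N - 1)) ?_ ?_
  · have h1 : (X ^ N - 1 : ℂ[X]).Separable :=
      (X_pow_sub_one_separable_iff).2 (by exact_mod_cast hN.ne')
    refine (Separable.mul separable_X h1 ?_).squarefree
    obtain ⟨M, rfl⟩ := Nat.exists_eq_succ_of_ne_zero hN.ne'
    exact ⟨X ^ M, -1, by rw [Nat.succ_eq_add_one]; ring⟩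
  · simp [mul_sub, ← pow_succ', hA]

/-- The traces of the powers of an operator `A` with `A ^ (N + 1) = A` are the values of one
integral polynomial at the powers of a primitive `N`-th root of unity. -/
theorem LinearMap.exists_trace_pow_eq_aeval {V : Type*} [AddCommGroup V] [Module ℂ V]
    [FiniteDimensional ℂ V] {N : ℕ} (hN : 0 < N) {ζ : ℂ} (hζ : IsPrimitiveRoot ζ N)
    {A : Module.End ℂ V} (hA : A ^ (N + 1) = A) :
    ∃ q : ℤ[X], ∀ m : ℕ, 0 < m → LinearMap.trace ℂ V (A ^ m) = aeval (ζ ^ m) q := by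
  classical
  have hss := Module.End.isSemisimple_of_pow_succ_eq_self hN hA
  have htop : ⨆ μ, A.eigenspace μ = ⊤ := by
    have := hss.isFinitelySemisimple.iSup_maxGenEigenspace_eq_top_iff.1
      (Module.End.iSup_maxGenEigenspace_eq_top A)
    exact this
  have hint : DirectSum.IsInternal A.eigenspace :=
    DirectSum.isInternal_submodule_of_iSupIndep_of_iSup_eq_top A.eigenspaces_iSupIndep htop
  have hfin : {μ | A.eigenspace μ ≠ ⊥}.Finite :=
    WellFoundedGT.finite_ne_bot_of_iSupIndep A.eigenspaces_iSupIndep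
  have hroot : ∀ μ : ℂ, A.eigenspace μ ≠ ⊥ → μ ≠ 0 → ∃ e : ℕ, ζ ^ e = μ := by
    intro μ hμ h0
    obtain ⟨v, hv, hv0⟩ := (Submodule.ne_bot_iff _).1 hμ
    have h1 : (A ^ (N + 1)) v = μ ^ (N + 1) • v :=
      (show A.HasEigenvector μ v from ⟨hv, hv0⟩).pow_apply _
    rw [hA, Module.End.mem_eigenspace_iff.1 hv] at h1
    have h2 : μ = μ ^ (N + 1) := smul_left_injective ℂ hv0 h1
    have h3 : μ ^ N = 1 := by
      rw [pow_succ] at h2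
      exact mul_right_cancel₀ h0 (by rw [one_mul]; exact h2.symm)
    have : NeZero N := ⟨hN.ne'⟩
    obtain ⟨e, -, he⟩ := hζ.eq_pow_of_pow_eq_one h3
    exact ⟨e, he⟩
  choose! e he using hroot
  -- Each nonzero eigenvalue μ = ζ^e contributes its multiplicity times X^e; the eigenvalue 0
  -- contributes nothing because m > 0.
  refine ⟨∑ μ ∈ hfin.toFinset with μ ≠ 0,
    C (Module.finrank ℂ (A.eigenspace μ) : ℤ) * X ^ e μ, fun m hm => ?_⟩
  have hmaps : ∀ μ, Set.MapsTo (A ^ m) (A.eigenspace μ) (A.eigenspace μ) := by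
    intro μ v hv
    have := Module.End.mapsTo_genEigenspace_of_comm ((Commute.refl A).pow_right m) μ 1
    exact this hv
  rw [LinearMap.trace_eq_sum_trace_restrict' hint hfin hmaps, map_sum]
  rw [Finset.sum_filter]
  refine Finset.sum_congr rfl fun μ hμ => ?_
  have hres : (A ^ m).restrict (hmaps μ) = μ ^ m • LinearMap.id := by
    ext ⟨v, hv⟩
    change (A ^ m) v = μ ^ m • v
    by_cases hv0 : v = 0
    · rw [hv0, map_zero, smul_zero]
    · exact (show A.HasEigenvector μ v from ⟨hv, hv0⟩).pow_apply m
  rw [hres, map_smul, LinearMap.trace_id]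
  split_ifs with h0
  · have h1 : (ζ ^ m) ^ e μ = μ ^ m := by
      rw [← pow_mul, mul_comm, pow_mul, he μ (by simpa using hμ) h0]
    simp [h1, mul_comm]
  · push Not at h0
    simp [h0, hm.ne']

theorem LinearMap.isIntegral_trace_of_pow_succ_eq_self {V : Type*} [AddCommGroup V] [Module ℂ V]
    [FiniteDimensional ℂ V] {N : ℕ} (hN : 0 < N) {A : Module.End ℂ V} (hA : A ^ (N + 1) = A) :
    IsIntegral ℤ (LinearMap.trace ℂ V A) := by
  have hζ := Complex.isPrimitiveRoot_exp N hN.ne'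
  obtain ⟨q, hq⟩ := LinearMap.exists_trace_pow_eq_aeval hN hζ hA
  have := hq 1 one_pos
  rw [pow_one, pow_one] at this
  rw [this]
  exact adjoin_le_integralClosure (hζ.isIntegral hN) (aeval_mem_adjoin_singleton ℤ _)

end PeriodicTraces

/-! ### Kronecker products and the cyclic shift. -/

section TensorPowers

open Matrix

variable {ι : Type*} [Fintype ι]

/-- The Kronecker product of a family of matrices indexed by `Fin n`. -/
def Matrix.kroneckerPi {n : ℕ} (A : Fin n → Matrix ι ι ℂ) :
    Matrix (Fin n → ι) (Fin n → ι) ℂ :=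
  Matrix.of fun i j => ∏ k, A k (i k) (j k)

theorem Matrix.kroneckerPi_mul {n : ℕ} (A B : Fin n → Matrix ι ι ℂ) :
    kroneckerPi A * kroneckerPi B = kroneckerPi fun k => A k * B k := by
  ext i j
  simp only [kroneckerPi, Matrix.mul_apply, Matrix.of_apply, ← Finset.prod_mul_distrib]
  rw [Finset.prod_univ_sum, Fintype.piFinset_univ]

variable [DecidableEq ι]

/-- The entries of a product of matrices are sums over paths. -/
theorem Matrix.prod_ofFn_apply {n : ℕ} (A : Fin (n + 1) → Matrix ι ι ℂ) (x y : ι) :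
    (List.ofFn A).prod x y =
      ∑ i : Fin n → ι, ∏ k, A k ((Fin.cons x i : Fin (n + 1) → ι) k)
        ((Fin.snoc i y : Fin (n + 1) → ι) k) := by
  induction n generalizing x with
  | zero => simp [Fin.snoc]
  | succ n ih =>
    rw [List.ofFn_succ, List.prod_cons, Matrix.mul_apply,
      ← (Fin.consEquiv fun _ : Fin (n + 1) => ι).sum_comp, Fintype.sum_prod_type]
    refine Finset.sum_congr rfl fun z _ => ?_
    rw [ih, Finset.mul_sum]
    refine Finset.sum_congr rfl fun i _ => ?_
    rw [Fin.prod_univ_succ (n := n + 1)]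
    simp [Fin.consEquiv, ← Fin.cons_snoc_eq_snoc_cons]

theorem finRotate_pow_self (n : ℕ) : finRotate n ^ n = 1 := by
  rcases n with _ | _ | n
  · simp
  · simp [finRotate_one]
    rfl
  · have := (isCycle_finRotate (n := n)).orderOf
    rw [support_finRotate, Finset.card_univ, Fintype.card_fin] at this
    rw [← orderOf_dvd_iff_pow_eq_one, this]

/-- The cyclic shift on the index set of an `n`-fold tensor power. -/
def cyclicShift (ι : Type*) (n : ℕ) : Equiv.Perm (Fin n → ι) :=
  (finRotate n).arrowCongr (Equiv.refl ι)

theorem cyclicShift_pow_self (ι : Type*) (n : ℕ) : cyclicShift ι n ^ n = 1 := by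
  have h : ∀ m : ℕ, ∀ i : Fin n → ι,
      (cyclicShift ι n ^ m) i = i ∘ ((finRotate n)⁻¹ ^ m : Equiv.Perm (Fin n)) := by
    intro m
    induction m with
    | zero => intro i; rfl
    | succ m ih =>
      intro i
      rw [pow_succ, Equiv.Perm.mul_apply, ih, pow_succ']
      rfl
  ext i : 1
  rw [h, inv_pow, finRotate_pow_self]
  rfl

theorem permMatrix_cyclicShift_pow_self (ι : Type*) [Fintype ι] [DecidableEq ι] (n : ℕ) :
    (cyclicShift ι n).permMatrix ℂ ^ n = 1 := by
  have h : ∀ m : ℕ, (cyclicShift ι n ^ m).permMatrix ℂ = (cyclicShift ι n).permMatrix ℂ ^ m := by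
    intro m
    induction m with
    | zero => simp
    | succ m ih => rw [pow_succ, Matrix.permMatrix_mul, ih, pow_succ']
  rw [← h, cyclicShift_pow_self, Matrix.permMatrix_one]

/-- Both sides sum the same products over closed paths: the shift feeds the column index of each
factor into the row index of the next. This turns a product in D(G) into an operator on a tensor
power. -/
theorem Matrix.trace_kroneckerPi_mul_permMatrix {n : ℕ} (A : Fin (n + 1) → Matrix ι ι ℂ) :
    (kroneckerPi A * (cyclicShift ι (n + 1)).permMatrix ℂ).trace =
      (List.ofFn A).prod.trace := by
  have h : ∀ i : Fin (n + 1) → ι,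
      (kroneckerPi A * (cyclicShift ι (n + 1)).permMatrix ℂ) i i =
        ∏ k, A k (i k) (i (finRotate _ k)) := by
    intro i
    rw [Equiv.Perm.permMatrix, PEquiv.mul_toMatrix_toPEquiv]
    rfl
  simp only [Matrix.trace, Matrix.diag, h, Matrix.prod_ofFn_apply]
  rw [← (Fin.consEquiv fun _ : Fin (n + 1) => ι).sum_comp, Fintype.sum_prod_type]
  refine Finset.sum_congr rfl fun x _ => Finset.sum_congr rfl fun i _ =>
    Finset.prod_congr rfl fun k _ => ?_
  congr 1
  refine Fin.lastCases ?_ (fun k => ?_) k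
  · simp [Fin.consEquiv]
  · simp [Fin.consEquiv]

theorem Matrix.permMatrix_mul_kroneckerPi {n : ℕ} (A : Fin n → Matrix ι ι ℂ) :
    (cyclicShift ι n).permMatrix ℂ * kroneckerPi (A ∘ (finRotate n).symm) =
      kroneckerPi A * (cyclicShift ι n).permMatrix ℂ := by
  ext i j
  rw [Equiv.Perm.permMatrix, PEquiv.mul_toMatrix_toPEquiv, PEquiv.toMatrix_toPEquiv_mul]
  simp only [Matrix.submatrix_apply, kroneckerPi, Matrix.of_apply, id]
  rw [← Equiv.prod_comp (finRotate n)]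
  refine Finset.prod_congr rfl fun k _ => ?_
  change A ((finRotate n).symm (finRotate n k)) (i ((finRotate n).symm (finRotate n k))) _ = _
  rw [Equiv.symm_apply_apply]
  rfl

end TensorPowers

/-! ### Sweedler powers in D(G) and root counts. -/

noncomputable section

namespace DrinfeldDouble

open scoped Classical Polynomial

open Polynomial (aeval)

attribute [local instance] Fintype.ofFinite

variable {G : Type u} [Group G] [Finite G]

instance : Module.Finite ℂ (DrinfeldDouble G) :=
  inferInstanceAs (Module.Finite ℂ ((G × G) →₀ ℂ))

instance : IsArtinianRing (DrinfeldDouble G) := IsArtinianRing.of_finite ℂ _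

theorem sweedlerPower_zero_bas (g h : G) :
    sweedlerPower (DrinfeldDouble G) 0 (bas g h) = if g = 1 then 1 else 0 := by
  simp [sweedlerPower, counit_bas, apply_ite (algebraMap ℂ (DrinfeldDouble G))]

theorem sweedlerPower_succ_bas (n : ℕ) (g h : G) :
    sweedlerPower (DrinfeldDouble G) (n + 1) (bas g h) =
      ∑ a : G, bas a h * sweedlerPower (DrinfeldDouble G) n (bas (a⁻¹ * g) h) := by
  have h1 : sweedlerPower (DrinfeldDouble G) (n + 1) (bas g h) =
      LinearMap.mul' ℂ (DrinfeldDouble G) (TensorProduct.map LinearMap.id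
        (sweedlerPower (DrinfeldDouble G) n) (Coalgebra.comul (bas g h))) := by
    rw [sweedlerPower, pow_succ']
    rfl
  rw [h1, comul_bas]
  simp

/-- The closed form of the Sweedler powers of the basis of `D(G)`. -/
theorem sweedlerPower_bas (n : ℕ) (g h : G) :
    sweedlerPower (DrinfeldDouble G) n (bas g h) =
      ∑ a : G, if (a * h⁻¹) ^ n * h ^ n = g then bas a (h ^ n) else 0 := by
  induction n generalizing g with
  | zero =>
    rw [sweedlerPower_zero_bas]
    simp only [pow_zero, mul_one, eq_comm (a := (1 : G))]
    split_ifs <;> simp [one_eq]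
  | succ n ih =>
    rw [sweedlerPower_succ_bas]
    refine Finset.sum_congr rfl fun b _ => ?_
    have hb : b = h * (h⁻¹ * b * h) * h⁻¹ := by group
    -- The product of e_b ⋈ h and e_c ⋈ h^n vanishes unless b = h c h⁻¹.
    rw [ih, Finset.mul_sum, Finset.sum_eq_single (h⁻¹ * b * h)]
    · have h2 : ((h⁻¹ * b * h * h⁻¹) ^ n * h ^ n = b⁻¹ * g) =
          ((b * h⁻¹) ^ (n + 1) * h ^ (n + 1) = g) := by
        have h3 : (b * h⁻¹) ^ (n + 1) * h ^ (n + 1) = b * ((h⁻¹ * b) ^ n * h ^ n) := by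
          have h4 : (b * h⁻¹) ^ n * b = b * (h⁻¹ * b) ^ n := by
            have : SemiconjBy b (h⁻¹ * b) (b * h⁻¹) := by simp [SemiconjBy, mul_assoc]
            exact (this.pow_right n).eq.symm
          rw [pow_succ, pow_succ', ← mul_assoc _ h, mul_assoc _ (b * h⁻¹), inv_mul_cancel_right,
            h4, mul_assoc]
        rw [h3, mul_inv_cancel_right, eq_inv_mul_iff_mul_eq]
      rw [mul_ite, mul_zero, bas_mul_bas, if_pos hb, if_congr h2.to_iff rfl rfl, pow_succ' h]
    · intro c _ hc
      have hb' : b ≠ h * c * h⁻¹ := fun hb' => hc (by rw [hb']; group)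
      rw [mul_ite, mul_zero, bas_mul_bas, if_neg hb', ite_self]
    · simp

/-- The Sweedler powers of the basis of `D(G)` as sums of products of basis vectors. -/
theorem sweedlerPower_bas_eq_sum_prod (n : ℕ) (g h : G) :
    sweedlerPower (DrinfeldDouble G) n (bas g h) =
      ∑ a : Fin n → G, if (List.ofFn a).prod = g then (List.ofFn fun k => bas (a k) h).prod
        else 0 := by
  induction n generalizing g with
  | zero => simp [sweedlerPower_zero_bas, eq_comm]
  | succ n ih =>
    rw [sweedlerPower_succ_bas, ← (Fin.consEquiv fun _ : Fin (n + 1) => G).sum_comp,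
      Fintype.sum_prod_type]
    refine Finset.sum_congr rfl fun b _ => ?_
    rw [ih, Finset.mul_sum]
    refine Finset.sum_congr rfl fun a _ => ?_
    simp only [Fin.consEquiv, Equiv.coe_fn_mk, List.ofFn_succ, Fin.cons_zero, Fin.cons_succ,
      List.prod_cons, mul_ite, mul_zero, eq_inv_mul_iff_mul_eq]

/-- The coefficient of `e_u ⋈ g` in `|G| Λ^[n]`. -/
def rootCount (n : ℕ) (u g : G) : ℕ :=
  (Finset.univ.filter fun h : G => (u * h⁻¹) ^ n * h ^ n = 1 ∧ h ^ n = g).card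

theorem sweedlerPower_integral (n : ℕ) :
    sweedlerPower (DrinfeldDouble G) n (integral G) =
      (Nat.card G : ℂ)⁻¹ • ∑ u : G, ∑ g : G, (rootCount n u g : ℂ) • bas u g := by
  rw [integral, map_smul, map_sum]
  congr 1
  simp only [sweedlerPower_bas]
  rw [Finset.sum_comm]
  refine Finset.sum_congr rfl fun u _ => ?_
  have h1 : ∀ g : G, (rootCount n u g : ℂ) • bas u g =
      ∑ h : G, if h ^ n = g then (if (u * h⁻¹) ^ n * h ^ n = 1 then bas u g else 0) else 0 := by
    intro g
    rw [rootCount, Nat.cast_smul_eq_nsmul, ← Finset.sum_const, Finset.sum_filter]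
    refine Finset.sum_congr rfl fun h _ => ?_
    rw [← ite_and]
    exact if_congr and_comm rfl rfl
  simp only [h1]
  rw [Finset.sum_comm]
  refine Finset.sum_congr rfl fun h _ => ?_
  simp

omit [Finite G] in
theorem commute_of_pow_eq {n : ℕ} {u g a b : G} (hu : u = a * b) (ha : a ^ n = g⁻¹)
    (hb : b ^ n = g) : Commute u g := by
  rw [hu]
  refine Commute.mul_left ?_ ?_
  · rw [← Commute.inv_right_iff, ← ha]; exact (Commute.refl a).pow_right n
  · rw [← hb]; exact (Commute.refl b).pow_right n

/-- The bijection is h ↦ a = u h⁻¹. Here a^n = g⁻¹, and a u⁻¹ is the conjugate of h⁻¹ by u, whose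
n-th power is again g⁻¹ because u commutes with g. -/
theorem rootCount_eq (n : ℕ) (u g : G) : rootCount n u g = (rootSet n u g⁻¹).ncard := by
  rw [rootCount, ← Set.ncard_coe_finset]
  refine Set.ncard_congr (fun h _ => u * h⁻¹) ?_ ?_ ?_
  · intro h hh
    simp only [Finset.coe_filter, Finset.mem_univ, true_and, Set.mem_ofPred_eq] at hh
    obtain ⟨h1, h2⟩ := hh
    have h3 : (u * h⁻¹) ^ n = g⁻¹ := by rw [← h2]; exact eq_inv_of_mul_eq_one_left h1
    have hc : Commute u g := commute_of_pow_eq (a := u * h⁻¹) (b := h) (by group) h3 h2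
    have h4 : (u * h⁻¹ * u⁻¹) ^ n = g⁻¹ := by
      rw [conj_pow, inv_pow, h2, hc.inv_right.eq, mul_inv_cancel_right]
    exact ⟨h4.trans h3.symm, h3⟩
  · intro a b _ _ hab
    simpa using hab
  · intro a ha
    obtain ⟨h1, h2⟩ := ha
    have hc : Commute u g := by
      have h3 : ((a * u⁻¹)⁻¹) ^ n = g := by rw [inv_pow, h1, h2, inv_inv]
      have h4 : Commute u⁻¹ g⁻¹ := by
        refine commute_of_pow_eq (n := n) (a := a⁻¹) (b := a * u⁻¹) (by group) ?_ ?_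
        · rw [inv_pow, h2]
        · rw [h1, h2]
      exact Commute.inv_inv_iff.1 h4
    refine ⟨a⁻¹ * u, ?_, by group⟩
    have h5 : (a⁻¹ * u) ^ n = g := by
      have h6 : a⁻¹ * u = u⁻¹ * (a * u⁻¹)⁻¹ * u⁻¹⁻¹ := by group
      rw [h6, conj_pow, inv_pow, h1, h2, inv_inv, hc.inv_left.eq,
        mul_inv_cancel_right]
    simp only [Finset.coe_filter, Finset.mem_univ, true_and, Set.mem_ofPred_eq]
    refine ⟨?_, h5⟩
    rw [h5]
    have h7 : u * (a⁻¹ * u)⁻¹ = a := by group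
    rw [h7, h2, inv_mul_cancel]

theorem commute_of_rootCount_ne_zero {n : ℕ} {u g : G} (h : rootCount n u g ≠ 0) :
    Commute u g := by
  obtain ⟨x, hx⟩ := Finset.card_ne_zero.1 h
  obtain ⟨h1, h2⟩ := (Finset.mem_filter.1 hx).2
  refine commute_of_pow_eq (n := n) (a := u * x⁻¹) (b := x) (by group) ?_ h2
  rw [← h2]; exact eq_inv_of_mul_eq_one_left h1

theorem rootCount_conj (n : ℕ) (u g k : G) :
    rootCount n (k * u * k⁻¹) (k * g * k⁻¹) = rootCount n u g := by
  refine (Finset.card_bij (fun h _ => k * h * k⁻¹) ?_ ?_ ?_).symm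
  · intro h hh
    obtain ⟨h1, h2⟩ := (Finset.mem_filter.1 hh).2
    refine Finset.mem_filter.2 ⟨Finset.mem_univ _, ?_, by rw [conj_pow, h2]⟩
    have h3 : k * u * k⁻¹ * (k * h * k⁻¹)⁻¹ = k * (u * h⁻¹) * k⁻¹ := by group
    rw [h3, conj_pow, conj_pow, conj_mul, h1, mul_one, mul_inv_cancel]
  · intro a _ b _ hab
    simpa using hab
  · intro h hh
    obtain ⟨h1, h2⟩ := (Finset.mem_filter.1 hh).2
    refine ⟨k⁻¹ * h * k, Finset.mem_filter.2 ⟨Finset.mem_univ _, ?_, ?_⟩, by group⟩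
    · have h3 : u * (k⁻¹ * h * k)⁻¹ = k⁻¹ * (k * u * k⁻¹ * h⁻¹) * k⁻¹⁻¹ := by group
      have h4 : k⁻¹ * h * k = k⁻¹ * h * k⁻¹⁻¹ := by group
      rw [h3, h4, conj_pow, conj_pow, conj_mul, h1, mul_one, mul_inv_cancel]
    · have h4 : k⁻¹ * h * k = k⁻¹ * h * k⁻¹⁻¹ := by group
      rw [h4, conj_pow, h2]
      group

/-- This makes e_u ⋈ g periodic, with (|G| + 1)-st power equal to itself. The exponent 0 is excluded
because e_u ⋈ 1 is in general not the unit. -/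
theorem bas_pow {u g : G} (h : Commute u g) {m : ℕ} (hm : 0 < m) :
    (bas u g : DrinfeldDouble G) ^ m = bas u (g ^ m) := by
  induction m, hm using Nat.le_induction with
  | base => simp
  | succ m hm ih =>
    rw [pow_succ, ih, bas_mul_bas, if_pos, pow_succ]
    rw [(h.symm.pow_left m).eq, mul_inv_cancel_right]

section Module

variable (V : Type*) [AddCommGroup V] [Module ℂ V] [Module (DrinfeldDouble G) V]
  [IsScalarTower ℂ (DrinfeldDouble G) V]

/-- The character of a `D(G)`-module. -/
def char : DrinfeldDouble G →ₗ[ℂ] ℂ :=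
  LinearMap.trace ℂ V ∘ₗ (Algebra.lsmul ℂ ℂ V : DrinfeldDouble G →ₐ[ℂ] Module.End ℂ V).toLinearMap

theorem char_apply (x : DrinfeldDouble G) :
    char V x = LinearMap.trace ℂ V (Algebra.lsmul ℂ ℂ V x) := rfl

theorem frobeniusSchurIndicator_integral (n : ℕ) :
    frobeniusSchurIndicator (integral G) n V =
      (Nat.card G : ℂ)⁻¹ * ∑ u : G, ∑ g : G, (rootCount n u g : ℂ) * char V (bas u g) := by
  rw [frobeniusSchurIndicator, ← char_apply, sweedlerPower_integral]
  simp

/-- At m = 1 the sum is |G| ν_n(V); for m coprime to |G| it is the Galois conjugate under ζ ↦ ζ^m. A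
single `Q` thus controls rationality of the indicator. -/
theorem exists_sum_char_eq_aeval [FiniteDimensional ℂ V] (n : ℕ) {ζ : ℂ}
    (hζ : IsPrimitiveRoot ζ (Nat.card G)) :
    ∃ Q : ℤ[X], ∀ m : ℕ, 0 < m →
      ∑ u : G, ∑ g : G, (rootCount n u g : ℂ) * char V (bas u (g ^ m)) = aeval (ζ ^ m) Q := by
  have h : ∀ u g : G, ∃ q : ℤ[X], ∀ m : ℕ, 0 < m →
      (rootCount n u g : ℂ) * char V (bas u (g ^ m)) = aeval (ζ ^ m) q := by
    intro u g
    by_cases h0 : rootCount n u g = 0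
    · exact ⟨0, by simp [h0]⟩
    have hc := commute_of_rootCount_ne_zero h0
    obtain ⟨q, hq⟩ := LinearMap.exists_trace_pow_eq_aeval (V := V) Nat.card_pos hζ
      (A := Algebra.lsmul ℂ ℂ V (bas u g)) (by
        rw [← map_pow, bas_pow hc (Nat.succ_pos _), pow_succ, pow_card_eq_one', one_mul])
    refine ⟨Polynomial.C (rootCount n u g : ℤ) * q, fun m hm => ?_⟩
    rw [char_apply, ← bas_pow hc hm, map_pow, hq m hm]
    simp
  choose q hq using h
  refine ⟨∑ u : G, ∑ g : G, q u g, fun m hm => ?_⟩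
  simp only [map_sum]
  exact Finset.sum_congr rfl fun u _ => Finset.sum_congr rfl fun g _ => hq u g m hm

end Module

/-! ### Indicators are algebraic integers. -/

section Integrality

open Matrix

variable {ι : Type*} [Fintype ι] [DecidableEq ι]

/-- The action of `|G|` times the integral of `D(G)` on the `n`-th tensor power. -/
def tensorIntegral (φ : DrinfeldDouble G →ₐ[ℂ] Matrix ι ι ℂ) (n : ℕ) :
    Matrix (Fin n → ι) (Fin n → ι) ℂ :=
  ∑ h : G, ∑ a : {a : Fin n → G // (List.ofFn a).prod = 1},
    kroneckerPi fun k => φ (bas (a.1 k) h)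

omit [Finite G] in
theorem prod_ofFn_conj {n : ℕ} (a : Fin n → G) (h : G) :
    (List.ofFn fun k => h * a k * h⁻¹).prod = h * (List.ofFn a).prod * h⁻¹ := by
  have := map_list_prod (MulAut.conj h) (List.ofFn a)
  rw [List.map_ofFn] at this
  exact this.symm

/-- Only the tuple `a'` with entries h⁻¹ a_k h survives in every tensor factor, and its product is
again 1. -/
theorem kroneckerPi_mul_sum (φ : DrinfeldDouble G →ₐ[ℂ] Matrix ι ι ℂ) {n : ℕ}
    (a : {a : Fin n → G // (List.ofFn a).prod = 1}) (h h' : G) :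
    ∑ a' : {a : Fin n → G // (List.ofFn a).prod = 1},
      kroneckerPi (fun k => φ (bas (a.1 k) h)) * kroneckerPi (fun k => φ (bas (a'.1 k) h')) =
      kroneckerPi fun k => φ (bas (a.1 k) (h * h')) := by
  have h0 : (List.ofFn fun k => h⁻¹ * a.1 k * h).prod = 1 := by
    have := prod_ofFn_conj a.1 h⁻¹
    simpa [a.2] using this
  simp only [kroneckerPi_mul, ← map_mul, bas_mul_bas]
  rw [Finset.sum_eq_single ⟨_, h0⟩]
  · congr 1
    ext1 k
    rw [if_pos (by group)]
  · rintro ⟨b, hb⟩ - hne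
    have : ∃ k, a.1 k ≠ h * b k * h⁻¹ := by
      by_contra! hall
      refine hne (Subtype.ext (funext fun k => ?_))
      change b k = h⁻¹ * a.1 k * h
      rw [hall k]; group
    obtain ⟨k, hk⟩ := this
    ext i j
    refine Finset.prod_eq_zero (Finset.mem_univ k) ?_
    simp [if_neg hk]
  · simp

theorem tensorIntegral_mul_self (φ : DrinfeldDouble G →ₐ[ℂ] Matrix ι ι ℂ) (n : ℕ) :
    tensorIntegral φ n * tensorIntegral φ n = (Nat.card G : ℂ) • tensorIntegral φ n := by
  have key : ∀ (h : G) (a : {a : Fin n → G // (List.ofFn a).prod = 1}),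
      kroneckerPi (fun k => φ (bas (a.1 k) h)) * tensorIntegral φ n =
        ∑ h' : G, kroneckerPi fun k => φ (bas (a.1 k) h') := by
    intro h a
    rw [tensorIntegral, Finset.mul_sum]
    simp only [Finset.mul_sum, kroneckerPi_mul_sum]
    exact Equiv.sum_comp (Equiv.mulLeft h) fun x => kroneckerPi fun k => φ (bas (a.1 k) x)
  conv_lhs => enter [1]; rw [tensorIntegral]
  simp only [Finset.sum_mul, key, Finset.sum_const, Finset.card_univ]
  rw [← Nat.card_eq_fintype_card, Nat.cast_smul_eq_nsmul, tensorIntegral, Finset.sum_comm]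

theorem prod_ofFn_comp_finRotate {n : ℕ} {a : Fin n → G} (ha : (List.ofFn a).prod = 1) :
    (List.ofFn (a ∘ finRotate n)).prod = 1 := by
  cases n with
  | zero => simp
  | succ n =>
    rw [List.ofFn_succ, List.prod_cons] at ha
    rw [List.ofFn_succ', List.concat_eq_append, List.prod_append, List.prod_singleton]
    simp only [Function.comp_apply, finRotate_last]
    have : (fun i : Fin n => a (finRotate (n + 1) i.castSucc)) = fun i => a i.succ := by
      ext i; simp
    rw [this]
    exact mul_eq_one_comm.1 ha

/-- The rotation of the tuples with product `1`. -/
def rotateTuples (G : Type*) [Group G] [Finite G] (n : ℕ) :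
    {a : Fin n → G // (List.ofFn a).prod = 1} ≃ {a : Fin n → G // (List.ofFn a).prod = 1} :=
  Equiv.ofBijective (fun a => ⟨a.1 ∘ finRotate n, prod_ofFn_comp_finRotate a.2⟩) <| by
    refine Finite.injective_iff_bijective.1 fun a b hab => Subtype.ext ?_
    have := congrArg Subtype.val hab
    exact (finRotate n).surjective.injective_comp_right this

/-- The shift rotates the tensor factors, and tuples with product 1 are stable under rotation, since
xy = 1 implies yx = 1. -/
theorem tensorIntegral_commute (φ : DrinfeldDouble G →ₐ[ℂ] Matrix ι ι ℂ) (n : ℕ) :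
    Commute (tensorIntegral φ n) ((cyclicShift ι n).permMatrix ℂ) := by
  rw [Commute, SemiconjBy, tensorIntegral, Finset.sum_mul, Finset.mul_sum]
  refine Finset.sum_congr rfl fun h _ => ?_
  rw [Finset.sum_mul, Finset.mul_sum, ← (rotateTuples G n).sum_comp]
  refine Finset.sum_congr rfl fun a _ => ?_
  rw [← permMatrix_mul_kroneckerPi]
  congr 2
  ext1 k
  change φ (bas (a.1 (finRotate n ((finRotate n).symm k))) h) = _
  rw [Equiv.apply_symm_apply]

theorem trace_tensorIntegral_mul (φ : DrinfeldDouble G →ₐ[ℂ] Matrix ι ι ℂ) (n : ℕ) :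
    (tensorIntegral φ (n + 1) * (cyclicShift ι (n + 1)).permMatrix ℂ).trace =
      (φ (sweedlerPower (DrinfeldDouble G) (n + 1) (∑ h : G, bas 1 h))).trace := by
  rw [tensorIntegral, Finset.sum_mul, trace_sum, map_sum, map_sum, trace_sum]
  refine Finset.sum_congr rfl fun h _ => ?_
  have h1 : ∀ a : Fin (n + 1) → G, (φ (if (List.ofFn a).prod = 1 then
      (List.ofFn fun k => bas (a k) h).prod else 0)).trace =
        if (List.ofFn a).prod = 1 then (φ (List.ofFn fun k => bas (a k) h).prod).trace else 0 := by
    intro a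
    split_ifs <;> simp
  rw [Finset.sum_mul, trace_sum, sweedlerPower_bas_eq_sum_prod, map_sum, trace_sum]
  simp only [h1]
  rw [← Finset.sum_filter,
    Finset.sum_subtype (p := fun a : Fin (n + 1) → G => (List.ofFn a).prod = 1) _ (by simp)]
  refine Finset.sum_congr rfl fun a _ => ?_
  rw [trace_kroneckerPi_mul_permMatrix, map_list_prod, List.map_ofFn]
  rfl

/-- The integral acts on the tensor power as an idempotent P commuting with the shift S, whose n-th
power is 1. Hence (PS)^(n+1) = PS, and the trace of PS, which is the indicator, is a sum of roots of
unity. -/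
theorem isIntegral_trace_sweedlerPower_integral (φ : DrinfeldDouble G →ₐ[ℂ] Matrix ι ι ℂ) {n : ℕ}
    (hn : 0 < n) :
    IsIntegral ℤ (φ (sweedlerPower (DrinfeldDouble G) n (integral G))).trace := by
  obtain ⟨n, rfl⟩ := Nat.exists_eq_succ_of_ne_zero hn.ne'
  have hG : (Nat.card G : ℂ) ≠ 0 := Nat.cast_ne_zero.mpr Nat.card_pos.ne'
  set P := (Nat.card G : ℂ)⁻¹ • tensorIntegral φ (n + 1) with hP
  set S := (cyclicShift ι (n + 1)).permMatrix ℂ with hS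
  have hPP : IsIdempotentElem P := by
    rw [IsIdempotentElem, hP, smul_mul_smul_comm, tensorIntegral_mul_self, smul_smul, mul_assoc,
      inv_mul_cancel₀ hG, mul_one]
  have hPS : Commute P S := (tensorIntegral_commute φ (n + 1)).smul_left _
  have hpow : (P * S) ^ (n + 1 + 1) = P * S := by
    rw [hPS.mul_pow, hPP.pow_succ_eq, pow_succ, permMatrix_cyclicShift_pow_self, one_mul]
  have htr : (φ (sweedlerPower (DrinfeldDouble G) (n + 1) (integral G))).trace = (P * S).trace := by
    rw [integral, map_smul, map_smul, trace_smul, ← trace_tensorIntegral_mul, hP, smul_mul_assoc,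
      trace_smul]
  rw [Nat.succ_eq_add_one, htr, ← Matrix.trace_toLin'_eq]
  refine LinearMap.isIntegral_trace_of_pow_succ_eq_self hn ?_
  change (Matrix.toLinAlgEquiv' (P * S)) ^ _ = Matrix.toLinAlgEquiv' (P * S)
  rw [← map_pow, hpow]

end Integrality

theorem isIntegral_frobeniusSchurIndicator (V : Type*) [AddCommGroup V] [Module ℂ V]
    [Module (DrinfeldDouble G) V] [IsScalarTower ℂ (DrinfeldDouble G) V] [FiniteDimensional ℂ V]
    {n : ℕ} (hn : 0 < n) : IsIntegral ℤ (frobeniusSchurIndicator (integral G) n V) := by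
  let b := Module.finBasis ℂ V
  have := isIntegral_trace_sweedlerPower_integral (G := G)
    ((LinearMap.toMatrixAlgEquiv b).toAlgHom.comp (Algebra.lsmul ℂ ℂ V)) hn
  rw [frobeniusSchurIndicator, LinearMap.trace_eq_matrix_trace ℂ b]
  exact this

/-! ### Central elements are detected by irreducible characters. -/

section Center

/-- By Schur's lemma `z` acts as a scalar c, so its character is c dim V. -/
theorem smul_eq_zero_of_char_eq_zero {V : Type*} [AddCommGroup V] [Module ℂ V]
    [Module (DrinfeldDouble G) V] [IsScalarTower ℂ (DrinfeldDouble G) V]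
    [IsSimpleModule (DrinfeldDouble G) V] [FiniteDimensional ℂ V] {z : DrinfeldDouble G}
    (hz : ∀ x, Commute z x) (h0 : char V z = 0) (v : V) : z • v = 0 := by
  let f : Module.End (DrinfeldDouble G) V :=
    { toFun := fun w => z • w
      map_add' := smul_add z
      map_smul' := fun x w => by
        rw [RingHom.id_apply, ← mul_smul, (hz x).eq, mul_smul] }
  obtain ⟨c, hc⟩ := (IsSimpleModule.algebraMap_end_bijective_of_isAlgClosed ℂ).2 f
  have hc' : ∀ w : V, z • w = c • w := fun w => congr($hc.symm w)
  have h1 : Algebra.lsmul ℂ ℂ V z = c • (LinearMap.id : V →ₗ[ℂ] V) := LinearMap.ext hc'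
  have := IsSimpleModule.nontrivial (DrinfeldDouble G) V
  rw [char_apply, h1, map_smul, LinearMap.trace_id, smul_eq_mul] at h0
  have hd : (Module.finrank ℂ V : ℂ) ≠ 0 := Nat.cast_ne_zero.2 Module.finrank_pos.ne'
  rw [hc', (mul_eq_zero.1 h0).resolve_right hd, zero_smul]

/-- The coefficient of `e_u ⋈ g`. -/
def coeff (u g : G) : DrinfeldDouble G →ₗ[ℂ] ℂ := lift fun a b => if a = u ∧ b = g then 1 else 0

theorem trace_lmul_bas (u g : G) :
    LinearMap.trace ℂ (DrinfeldDouble G) (Algebra.lmul ℂ (DrinfeldDouble G) (bas u g)) =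
      if g = 1 then (Nat.card G : ℂ) else 0 := by
  let b : Module.Basis (G × G) ℂ (DrinfeldDouble G) := Finsupp.basisSingleOne
  have hb : ∀ p, b p = bas p.1 p.2 := fun p =>
    congrFun Finsupp.coe_basisSingleOne p
  have hr : ∀ (c d : G) p, b.repr (bas c d) p = if (c, d) = p then 1 else 0 := by
    intro c d p
    rw [← hb (c, d), Module.Basis.repr_self, Finsupp.single_apply]
  rw [LinearMap.trace_eq_matrix_trace ℂ b, Matrix.trace]
  have h1 : ∀ p : G × G, (LinearMap.toMatrix b b
      (Algebra.lmul ℂ (DrinfeldDouble G) (bas u g))).diag p =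
        if g = 1 ∧ p.1 = u then 1 else 0 := by
    intro p
    rw [Matrix.diag_apply, LinearMap.toMatrix_apply, hb]
    change b.repr (bas u g * bas p.1 p.2) p = _
    rw [bas_mul_bas]
    by_cases hg : g = 1
    · subst hg
      by_cases hp : p.1 = u
      · simp [hp, hr, Prod.ext_iff]
      · simp [hp, Ne.symm hp]
    · rw [if_neg (c := g = 1 ∧ p.1 = u) fun h => hg h.1]
      split_ifs with h2
      · rw [hr, if_neg]
        intro h3
        exact hg (by simpa using congrArg Prod.snd h3)
      · rw [map_zero, Finsupp.zero_apply]
  simp only [h1]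
  rw [Fintype.sum_prod_type]
  by_cases hg : g = 1 <;> simp [hg, Nat.card_eq_fintype_card]

/-- The regular trace sees only the terms e_a ⋈ 1, and the right factor moves e_u ⋈ g, and no other
basis vector, to such a term. -/
theorem trace_lmul_mul_bas (z : DrinfeldDouble G) (u g : G) :
    LinearMap.trace ℂ (DrinfeldDouble G)
      (Algebra.lmul ℂ (DrinfeldDouble G) (z * bas (g⁻¹ * u * g) g⁻¹)) =
      Nat.card G * coeff u g z := by
  have : LinearMap.trace ℂ (DrinfeldDouble G) ∘ₗ
      (Algebra.lmul ℂ (DrinfeldDouble G)).toLinearMap ∘ₗ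
        LinearMap.mulRight ℂ (bas (g⁻¹ * u * g) g⁻¹) = (Nat.card G : ℂ) • coeff u g := by
    refine hom_ext fun a b => ?_
    simp only [LinearMap.comp_apply, LinearMap.mulRight_apply, AlgHom.toLinearMap_apply,
      LinearMap.smul_apply, coeff, lift_bas, bas_mul_bas, smul_eq_mul]
    by_cases hb : b = g
    · subst hb
      have h2 : b * (b⁻¹ * u * b) * b⁻¹ = u := by group
      rw [h2]
      by_cases ha : a = u
      · rw [if_pos ha, if_pos ⟨ha, rfl⟩, mul_inv_cancel, trace_lmul_bas, if_pos rfl, mul_one]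
      · rw [if_neg ha, if_neg fun h => ha h.1, map_zero, map_zero, mul_zero]
    · have h3 : b * g⁻¹ ≠ 1 := fun h => hb (mul_inv_eq_one.1 h)
      rw [if_neg (c := a = u ∧ b = g) fun h => hb h.2, mul_zero]
      split_ifs
      · rw [trace_lmul_bas, if_neg h3]
      · rw [map_zero, map_zero]
  exact congr($this z)

/-- A central element of `D(G)` on which all irreducible characters vanish is zero. -/
theorem coeff_eq_zero_of_char_eq_zero {z : DrinfeldDouble G} (hz : ∀ x, Commute z x)
    (h0 : ∀ (V : Type u) [AddCommGroup V] [Module ℂ V] [Module (DrinfeldDouble G) V]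
      [IsScalarTower ℂ (DrinfeldDouble G) V] [IsSimpleModule (DrinfeldDouble G) V]
      [FiniteDimensional ℂ V], char V z = 0) (u g : G) : coeff u g z = 0 := by
  -- `z` kills the class of 1 in each simple quotient, so it lies in every maximal left ideal. The
  -- radical is nilpotent, hence so is z y, and its regular trace, |G| times the coefficient,
  -- vanishes.
  have hJ : z ∈ (⊥ : Ideal (DrinfeldDouble G)).jacobson := by
    rw [Ideal.jacobson, Ideal.mem_sInf]
    rintro I ⟨-, hI⟩
    have hs : IsSimpleModule (DrinfeldDouble G) (DrinfeldDouble G ⧸ I) :=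
      isSimpleModule_iff_isCoatom.2 hI.out
    have hf : FiniteDimensional ℂ (DrinfeldDouble G ⧸ I) :=
      Module.Finite.trans (DrinfeldDouble G) _
    have h1 := smul_eq_zero_of_char_eq_zero (V := DrinfeldDouble G ⧸ I) hz
      (h0 (DrinfeldDouble G ⧸ I)) (Submodule.Quotient.mk 1)
    rw [← Submodule.Quotient.mk_smul, smul_eq_mul, mul_one] at h1
    exact (Submodule.Quotient.mk_eq_zero I).1 h1
  obtain ⟨k, hk⟩ := IsArtinianRing.isNilpotent_jacobson_bot (R := DrinfeldDouble G)
  set y : DrinfeldDouble G := bas (g⁻¹ * u * g) g⁻¹ with hy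
  have hzy : (z * y) ^ k = 0 := by
    have h1 : z * y ∈ (⊥ : Ideal (DrinfeldDouble G)).jacobson := by
      rw [(hz y).eq]; exact Ideal.mul_mem_left _ _ hJ
    have h2 := Ideal.pow_mem_pow h1 k
    rw [hk] at h2
    simpa using h2
  have h3 : IsNilpotent (Algebra.lmul ℂ (DrinfeldDouble G) (z * y)) :=
    ⟨k, by rw [← map_pow, hzy, map_zero]⟩
  have h4 := (LinearMap.isNilpotent_trace_of_isNilpotent h3).eq_zero
  rw [hy, trace_lmul_mul_bas] at h4
  exact (mul_eq_zero.1 h4).resolve_left (Nat.cast_ne_zero.mpr Nat.card_pos.ne')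

/-- Multiplication by e_c ⋈ k selects u = c on one side and u = k⁻¹ c k on the other; conjugation
invariance of `rootCount` matches the two sums. -/
theorem commute_sum_rootCount_smul (n m : ℕ) (x : DrinfeldDouble G) :
    Commute (∑ u : G, ∑ g : G, (rootCount n u g : ℂ) • (bas u (g ^ m) : DrinfeldDouble G)) x := by
  set z : DrinfeldDouble G := ∑ u : G, ∑ g : G, (rootCount n u g : ℂ) • bas u (g ^ m) with hz
  have : LinearMap.mulLeft ℂ z = LinearMap.mulRight ℂ z := by
    refine hom_ext fun c k => ?_
    simp only [LinearMap.mulLeft_apply, LinearMap.mulRight_apply, hz, Finset.sum_mul,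
      Finset.mul_sum, smul_mul_assoc, mul_smul_comm]
    have hL : ∀ u : G, u ≠ c → ∑ g : G, (rootCount n u g : ℂ) •
        (bas u (g ^ m) * bas c k : DrinfeldDouble G) = 0 := by
      intro u hu
      refine Finset.sum_eq_zero fun g _ => ?_
      by_cases h0 : rootCount n u g = 0
      · simp [h0]
      have hc := commute_of_rootCount_ne_zero h0
      rw [bas_mul_bas, if_neg, smul_zero]
      intro h
      refine hu ?_
      have h3 : c = (g ^ m)⁻¹ * u * g ^ m := by rw [h]; group
      rw [h3, mul_assoc, (hc.pow_right m).eq, inv_mul_cancel_left]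
    have hR : ∀ u : G, u ≠ k⁻¹ * c * k → ∑ g : G, (rootCount n u g : ℂ) •
        (bas c k * bas u (g ^ m) : DrinfeldDouble G) = 0 := by
      intro u hu
      refine Finset.sum_eq_zero fun g _ => ?_
      rw [bas_mul_bas, if_neg, smul_zero]
      intro h
      exact hu (by rw [h]; group)
    rw [Finset.sum_eq_single_of_mem c (Finset.mem_univ _) fun u _ => hL u,
      Finset.sum_eq_single_of_mem (k⁻¹ * c * k) (Finset.mem_univ _) fun u _ => hR u,
      ← Equiv.sum_comp (MulAut.conj k⁻¹).toEquiv fun g => (rootCount n (k⁻¹ * c * k) g : ℂ) •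
        (bas c k * bas (k⁻¹ * c * k) (g ^ m) : DrinfeldDouble G)]
    refine Finset.sum_congr rfl fun g _ => ?_
    have h1 : (MulAut.conj k⁻¹).toEquiv g = k⁻¹ * g * k⁻¹⁻¹ := rfl
    have h2 : k⁻¹ * c * k = k⁻¹ * c * k⁻¹⁻¹ := by group
    rw [h1, h2, rootCount_conj, conj_pow, bas_mul_bas, bas_mul_bas]
    by_cases h0 : rootCount n c g = 0
    · simp [h0]
    have hc := commute_of_rootCount_ne_zero h0
    rw [if_pos (by rw [(hc.symm.pow_left m).eq, mul_inv_cancel_right]), if_pos (by group)]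
    congr 2
    group
  exact congr($this x)

end Center

/-! ### The counting criterion for FSZ_n. -/

/-- `G` is an `FSZ_n`-group if and only if the coefficients of `Λ^[n]` are Galois-invariant. -/
theorem isFSZ_iff_rootCount {n : ℕ} (hn : 0 < n) :
    IsFSZ n G ↔ ∀ m : ℕ, m.Coprime (Nat.card G) → ∀ u g : G,
      rootCount n u (g ^ m) = rootCount n u g := by
  have hG : 0 < Nat.card G := Nat.card_pos
  have hG0 : (Nat.card G : ℂ) ≠ 0 := Nat.cast_ne_zero.mpr hG.ne'
  obtain ⟨ζ, hζ⟩ : ∃ ζ : ℂ, IsPrimitiveRoot ζ (Nat.card G) :=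
    ⟨_, Complex.isPrimitiveRoot_exp _ hG.ne'⟩
  have hperm : ∀ {m : ℕ}, m.Coprime (Nat.card G) → ∀ f : G → ℂ,
      ∑ g : G, f (g ^ m) = ∑ g : G, f g := fun hm f => (powCoprime hm.symm).sum_comp f
  have hshift : ∀ {m : ℕ}, m.Coprime (Nat.card G) → (m + Nat.card G).Coprime (Nat.card G) :=
    fun hm => by simpa using hm
  constructor
  · intro hF m hm u g
    -- The shift makes the exponent positive without changing powers in G; m = 0 can occur when |G|
    -- = 1.
    set m' := m + Nat.card G with hm'
    have hpos : 0 < m' := by omega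
    have hg : ∀ x : G, x ^ m = x ^ m' := fun x => by rw [hm', pow_add, pow_card_eq_one', mul_one]
    have hcop := hshift hm
    set z : DrinfeldDouble G := ∑ u : G, ∑ g : G, (rootCount n u g : ℂ) • bas u (g ^ m') -
      ∑ u : G, ∑ g : G, (rootCount n u g : ℂ) • bas u (g ^ 1) with hz
    have h1 : coeff u (g ^ m') z = 0 := by
      refine coeff_eq_zero_of_char_eq_zero (fun x => (commute_sum_rootCount_smul n m' x).sub_left
        (commute_sum_rootCount_smul n 1 x)) ?_ _ _
      intro V _ _ _ _ _ _
      obtain ⟨k, hk⟩ := hF V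
      rw [frobeniusSchurIndicator_integral, inv_mul_eq_iff_eq_mul₀ hG0] at hk
      obtain ⟨Q, hQ⟩ := exists_sum_char_eq_aeval V n hζ
      have hQ1 := hQ 1 one_pos
      simp only [pow_one] at hQ1
      rw [hk] at hQ1
      have h2 := hζ.aeval_pow_eq_of_aeval_eq_intCast hG (k := Nat.card G * k)
        (by rw [← hQ1]; push_cast; rfl) hcop
      rw [← hQ m' hpos] at h2
      rw [hz, map_sub]
      simp only [map_sum, map_smul, smul_eq_mul, pow_one]
      rw [h2, hk]
      push_cast
      ring
    have hcoeff : ∀ {j : ℕ}, j.Coprime (Nat.card G) → ∀ a b : G, coeff a (b ^ j)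
        (∑ u : G, ∑ g : G, (rootCount n u g : ℂ) • bas u (g ^ j)) = rootCount n a b := by
      intro j hj a b
      have hinj : ∀ x : G, x ^ j = b ^ j ↔ x = b := fun x =>
        (powCoprime hj.symm).injective.eq_iff
      simp only [map_sum, map_smul, coeff, lift_bas, hinj, smul_eq_mul, mul_ite, mul_one, mul_zero]
      rw [Finset.sum_eq_single a, Finset.sum_eq_single b]
      · simp
      · intro x _ hx; simp [hx]
      · simp
      · intro x _ hx; simp [hx]
      · simp
    -- At e_u ⋈ g^m' the first sum has coefficient `rootCount n u g`, the second `rootCount n u (g ^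
    -- m')`.
    rw [hz, map_sub, hcoeff hcop] at h1
    have h2 := hcoeff (Nat.coprime_one_left (Nat.card G)) u (g ^ m')
    rw [pow_one] at h2
    rw [h2, sub_eq_zero] at h1
    rw [hg]
    exact_mod_cast h1.symm
  · intro hN V _ _ _ _ _
    have hf : FiniteDimensional ℂ V := Module.Finite.trans (DrinfeldDouble G) _
    obtain ⟨Q, hQ⟩ := exists_sum_char_eq_aeval V n hζ
    have h1 : ∀ m : ℕ, m.Coprime (Nat.card G) → aeval (ζ ^ m) Q =
        ∑ u : G, ∑ g : G, (rootCount n u g : ℂ) * char V (bas u g) := by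
      intro m hm
      have hm' := hshift hm
      have h2 : ζ ^ m = ζ ^ (m + Nat.card G) := by rw [pow_add, hζ.pow_eq_one, mul_one]
      rw [h2, ← hQ _ (by omega)]
      refine Finset.sum_congr rfl fun u _ => ?_
      rw [← hperm hm' fun g => (rootCount n u g : ℂ) * char V (bas u g)]
      refine Finset.sum_congr rfl fun g _ => ?_
      rw [hN _ hm']
    obtain ⟨k, hk⟩ := hζ.exists_intCast_eq_of_forall_aeval_pow_eq hG h1
    -- So far only |G| ν_n(V) is known to be an integer; a rational algebraic integer is an integer.
    have hint := isIntegral_frobeniusSchurIndicator (G := G) V hn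
    rw [frobeniusSchurIndicator_integral, hk] at hint ⊢
    have h3 : ((Nat.card G : ℂ)⁻¹ * k) = algebraMap ℚ ℂ ((Nat.card G : ℚ)⁻¹ * k) := by simp
    rw [h3, isIntegral_algebraMap_iff (algebraMap ℚ ℂ).injective,
      IsIntegrallyClosed.isIntegral_iff] at hint
    obtain ⟨y, hy⟩ := hint
    refine ⟨y, ?_⟩
    rw [h3, ← hy]
    simp

/-- `G` is an `FSZ_n`-group if and only if `|G_n(u, g)| = |G_n(u, g ^ m)|` for all commuting `u, g`
and all `m` coprime to `|G|`. -/
theorem isFSZ_iff_ncard_rootSet {n : ℕ} (hn : 0 < n) :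
    IsFSZ n G ↔ ∀ u g : G, Commute u g → ∀ m : ℤ, Int.gcd m (Nat.card G) = 1 →
      (rootSet n u (g ^ m)).ncard = (rootSet n u g).ncard := by
  have hcard : ∀ u g : G, (rootSet n u g).ncard = rootCount n u g⁻¹ := fun u g => by
    rw [rootCount_eq, inv_inv]
  have hG : (Nat.card G : ℤ) ≠ 0 := by exact_mod_cast Nat.card_pos.ne'
  rw [isFSZ_iff_rootCount hn]
  constructor
  · intro h u g _ m hm
    obtain ⟨k, hk⟩ := Int.eq_ofNat_of_zero_le (Int.emod_nonneg m hG)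
    have hgk : g ^ m = g ^ k := by rw [← zpow_natCast, ← hk, zpow_mod_natCard]
    have hcop : k.Coprime (Nat.card G) := by
      rw [Nat.Coprime, ← Int.gcd_natCast_natCast, ← hk, Int.gcd_emod, hm]
    rw [hcard, hcard, hgk, ← inv_pow, h k hcop]
  · intro h m hm u g
    by_cases hc : Commute u g
    · have := h u g⁻¹ hc.inv_right m (by simpa using hm)
      rw [hcard, hcard, inv_inv, zpow_natCast, inv_pow, inv_inv] at this
      exact this
    · have h1 : rootCount n u g = 0 := by
        by_contra h0; exact hc (commute_of_rootCount_ne_zero h0)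
      have h2 : rootCount n u (g ^ m) = 0 := by
        by_contra h0
        have h3 := commute_of_rootCount_ne_zero h0
        -- As g is a power of g^m, noncommuting u, g give noncommuting u, g^m, and both counts are
        -- 0.
        obtain ⟨j, hj⟩ := exists_pow_eq_self_of_coprime (x := g) (n := m)
          (hm.coprime_dvd_right (orderOf_dvd_natCard g))
        rw [← hj] at hc
        exact hc (h3.pow_right j)
      rw [h1, h2]

end DrinfeldDouble

/-! ### Characters determine complex representations. -/

section Characters

variable {H V W V' W' : Type*} [Group H] [AddCommGroup V] [Module ℂ V] [AddCommGroup W]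
  [Module ℂ W] [AddCommGroup V'] [Module ℂ V'] [AddCommGroup W'] [Module ℂ W']

namespace Representation

variable {ρ : Representation ℂ H V} {σ : Representation ℂ H W} {ρ' : Representation ℂ H V'}
  {σ' : Representation ℂ H W'}

/-- The product of two equivalences of representations. -/
def Equiv.prodCongr (e : ρ.Equiv σ) (e' : ρ'.Equiv σ') : (ρ.prod ρ').Equiv (σ.prod σ') :=
  Equiv.mk (e.toLinearEquiv.prodCongr e'.toLinearEquiv) fun g =>
    LinearMap.ext fun x => Prod.ext (IntertwiningMap.isIntertwining ρ σ e.toIntertwiningMap g x.1)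
      (IntertwiningMap.isIntertwining ρ' σ' e'.toIntertwiningMap g x.2)

/-- A representation is the direct sum of two complementary subrepresentations. -/
def prodEquivOfIsCompl (p q : Subrepresentation ρ) (h : IsCompl p.toSubmodule q.toSubmodule) :
    (p.toRepresentation.prod q.toRepresentation).Equiv ρ :=
  Equiv.mk (Submodule.prodEquivOfIsCompl _ _ h) fun g => by
    ext x <;> simp [Subrepresentation.toRepresentation]

theorem isCompl_toSubmodule {p q : Subrepresentation ρ} (h : IsCompl p q) :
    IsCompl p.toSubmodule q.toSubmodule := by
  refine IsCompl.of_eq ?_ ?_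
  · exact congrArg Subrepresentation.toSubmodule h.inf_eq_bot
  · exact congrArg Subrepresentation.toSubmodule h.sup_eq_top

theorem character_prod [FiniteDimensional ℂ V] [FiniteDimensional ℂ V'] (g : H) :
    (ρ.prod ρ').character g = ρ.character g + ρ'.character g :=
  LinearMap.trace_prodMap' _ _

/-- An intertwining map restricts to an equivalence from a complement of its kernel to its
range. -/
theorem nonempty_equiv_range_of_isCompl_ker (f : IntertwiningMap ρ σ) {p : Subrepresentation ρ}
    (h : IsCompl f.ker.toSubmodule p.toSubmodule) :
    Nonempty (p.toRepresentation.Equiv f.range.toRepresentation) := by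
  let F : p.toSubmodule →ₗ[ℂ] f.range.toSubmodule :=
    (f.toLinearMap.domRestrict p.toSubmodule).codRestrict f.range.toSubmodule
      fun x => (IntertwiningMap.mem_range ρ σ f _).2 ⟨x, rfl⟩
  have hF : Function.Bijective F := by
    constructor
    · rw [injective_iff_map_eq_zero]
      rintro ⟨x, hx⟩ h0
      have h1 : x ∈ f.ker.toSubmodule := congrArg Subtype.val h0
      exact Subtype.ext ((Submodule.disjoint_def.1 h.disjoint) x h1 hx)
    · rintro ⟨y, hy⟩
      obtain ⟨x, rfl⟩ := (IntertwiningMap.mem_range ρ σ f _).1 hy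
      obtain ⟨a, ha, b, hb, rfl⟩ := Submodule.mem_sup.1 (h.sup_eq_top ▸ Submodule.mem_top (x := x))
      refine ⟨⟨b, hb⟩, Subtype.ext ?_⟩
      have h1 : f a = 0 := ha
      change f b = f (a + b)
      rw [map_add, h1, zero_add]
  refine ⟨Equiv.mk (LinearEquiv.ofBijective F hF) fun g => ?_⟩
  ext x
  exact IntertwiningMap.isIntertwining ρ σ f g x

/-- Complex representations of a finite group with the same character are isomorphic. -/
theorem nonempty_equiv_of_character_eq [Finite H] [FiniteDimensional ℂ V] [FiniteDimensional ℂ W]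
    (h : ρ.character = σ.character) : Nonempty (ρ.Equiv σ) := by
  classical
  have := Fintype.ofFinite H
  have hH : (Nat.card H : ℂ) ≠ 0 := Nat.cast_ne_zero.mpr Nat.card_pos.ne'
  have := invertibleOfNonzero hH
  have : NeZero (Nat.card H : ℂ) := ⟨hH⟩
  obtain ⟨d, hd⟩ : ∃ d, Module.finrank ℂ V = d := ⟨_, rfl⟩
  induction d using Nat.strong_induction_on generalizing V W with
  | _ d ih =>
  have hfin : Module.finrank ℂ V = Module.finrank ℂ W := by
    have := congrFun h 1
    rw [char_one, char_one] at this
    exact_mod_cast this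
  rcases Nat.eq_zero_or_pos d with h0 | h0
  · have hV : Subsingleton V := Module.finrank_zero_iff.1 (hd.trans h0)
    have hW : Subsingleton W := Module.finrank_zero_iff.1 (hfin ▸ hd.trans h0)
    exact ⟨Equiv.mk (LinearEquiv.ofFinrankEq V W hfin) fun g =>
      LinearMap.ext fun x => Subsingleton.elim _ _⟩
  have hV : Nontrivial V := Module.finrank_pos_iff.1 (hd ▸ h0)
  -- Hom(ρ, σ) and End(ρ) have the same dimension by the character formula, which yields a nonzero
  -- f. Its kernel and a complement of its range then have equal characters in smaller dimension.
  have hHom : (Module.finrank ℂ (IntertwiningMap ρ σ) : ℂ) =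
      Module.finrank ℂ (IntertwiningMap ρ ρ) := by
    rw [← card_inv_mul_sum_char_mul_char_eq_finrank, ← card_inv_mul_sum_char_mul_char_eq_finrank,
      h]
  have hρ : Nontrivial (IntertwiningMap ρ ρ) := by
    obtain ⟨v, hv⟩ := exists_ne (0 : V)
    exact ⟨IntertwiningMap.id ρ, 0, fun he => hv congr($he v)⟩
  have hσ : Nontrivial (IntertwiningMap ρ σ) := by
    refine Module.nontrivial_of_finrank_pos (R := ℂ) ?_
    have h1 : Module.finrank ℂ (IntertwiningMap ρ σ) = Module.finrank ℂ (IntertwiningMap ρ ρ) := by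
      exact_mod_cast hHom
    rw [h1]
    exact Module.finrank_pos
  obtain ⟨f, hf⟩ := exists_ne (0 : IntertwiningMap ρ σ)
  have : IsSemisimpleRepresentation ρ :=
    (isSemisimpleRepresentation_iff_isSemisimpleModule_asModule ρ).2 inferInstance
  have : IsSemisimpleRepresentation σ :=
    (isSemisimpleRepresentation_iff_isSemisimpleModule_asModule σ).2 inferInstance
  obtain ⟨p, hp⟩ := exists_isCompl f.ker
  obtain ⟨q, hq⟩ := exists_isCompl f.range
  replace hp := isCompl_toSubmodule hp
  replace hq := isCompl_toSubmodule hq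
  obtain ⟨e⟩ := nonempty_equiv_range_of_isCompl_ker f hp
  have eV := prodEquivOfIsCompl _ _ hp
  have eW := prodEquivOfIsCompl _ _ hq.symm
  have hker : f.ker.toRepresentation.character = q.toRepresentation.character := by
    ext g
    have h1 := congrFun h g
    rw [← char_iso eV, ← char_iso eW, character_prod, character_prod, char_iso e] at h1
    exact add_right_cancel h1
  have hlt : Module.finrank ℂ f.ker.toSubmodule < d := by
    rw [← hd]
    refine Submodule.finrank_lt fun htop => hf ?_
    ext x
    have : x ∈ f.ker.toSubmodule := htop ▸ Submodule.mem_top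
    exact this
  obtain ⟨e'⟩ := ih _ hlt hker rfl
  exact ⟨(eV.symm.trans (e'.prodCongr e)).trans eW⟩

end Representation

end Characters

theorem Representation.character_ofMulAction {H X : Type*} [Group H] [MulAction H X] [Finite X]
    (k : H) : (Representation.ofMulAction ℂ H X).character k = Nat.card (MulAction.fixedBy X k) := by
  classical
  have := Fintype.ofFinite X
  let b : Module.Basis X ℂ (MonoidAlgebra ℂ X) :=
    Module.Basis.ofRepr (MonoidAlgebra.coeffLinearEquiv ℂ)
  have hb : ∀ x, b x = MonoidAlgebra.single x 1 := fun x => rfl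
  rw [Representation.character, LinearMap.trace_eq_matrix_trace ℂ b, Matrix.trace]
  have h1 : ∀ x, (LinearMap.toMatrix b b (Representation.ofMulAction ℂ H X k)).diag x =
      if k • x = x then 1 else 0 := by
    intro x
    rw [Matrix.diag_apply, LinearMap.toMatrix_apply, hb, Representation.ofMulAction_single]
    exact Finsupp.single_apply
  simp only [h1]
  rw [Finset.sum_boole, ← Set.ncard_coe_finset, Nat.card_coe_set_eq]
  congr 2
  ext x
  simp

/-! ### Fixed points and centralizers. -/

section FixedPoints

variable {G : Type*} [Group G]

/-- The elements of `G_n(u, g)` that commute with `x`. -/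
def fixedRootSet (n : ℕ) (x u g : G) : Set G := {a | a ∈ rootSet n u g ∧ Commute x a}

theorem fixedRootSet_one (n : ℕ) (u g : G) : fixedRootSet n 1 u g = rootSet n u g := by
  ext a
  exact and_iff_left (Commute.one_left a)

/-- Each a in G_n(u, g) commutes with its own power a^n = g. This is what disposes of the identity
element in the main theorem. -/
theorem fixedRootSet_of_mem_zpowers (n : ℕ) (u : G) {x g : G} (hx : x ∈ Subgroup.zpowers g) :
    fixedRootSet n x u g = rootSet n u g := by
  ext a
  refine ⟨fun h => h.1, fun h => ⟨h, ?_⟩⟩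
  obtain ⟨k, rfl⟩ := Subgroup.mem_zpowers_iff.1 hx
  rw [← h.2]
  exact ((Commute.refl a).pow_left n).zpow_left k

theorem ncard_rootSet_centralizer (n : ℕ) (x : G) (u g : Subgroup.centralizer {x}) :
    (rootSet n u g).ncard = (fixedRootSet n x (u : G) g).ncard := by
  rw [← Set.ncard_image_of_injective _ Subtype.val_injective]
  congr 1
  ext a
  constructor
  · rintro ⟨a, ⟨h1, h2⟩, rfl⟩
    exact ⟨⟨congrArg Subtype.val h1, congrArg Subtype.val h2⟩,
      (Subgroup.mem_centralizer_iff.1 a.2) x rfl⟩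
  · rintro ⟨⟨h1, h2⟩, h3⟩
    exact ⟨⟨a, Subgroup.mem_centralizer_iff.2 (by rintro _ rfl; exact h3)⟩,
      ⟨Subtype.ext h1, Subtype.ext h2⟩, rfl⟩

theorem mem_centralizer_pair {x u g : G} :
    x ∈ Subgroup.centralizer {u, g} ↔ Commute x u ∧ Commute x g := by
  rw [Subgroup.mem_centralizer_iff]
  simp only [Set.mem_insert_iff, Set.mem_singleton_iff, forall_eq_or_imp, forall_eq]
  exact and_congr eq_comm eq_comm

variable [Finite G]

instance {X : Type*} [Finite X] :
    FiniteDimensional ℂ (MonoidAlgebra ℂ X) :=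
  Module.Finite.equiv (MonoidAlgebra.coeffLinearEquiv ℂ (M := X)).symm

theorem character_permRep (n : ℕ) (u g : G) {g' : G} (hg' : g' ∈ Subgroup.zpowers g)
    (k : Subgroup.centralizer {u, g}) :
    (permRep n u g hg').character k = (fixedRootSet n (k : G) u g').ncard := by
  let _ := conjAction n u g hg'
  refine (Representation.character_ofMulAction k).trans ?_
  rw [Nat.card_coe_set_eq, ← Set.ncard_image_of_injective _ Subtype.val_injective]
  congr 2
  ext a
  have key : ∀ a : rootSet n u g', k • a = a ↔ Commute (k : G) a := by
    intro a
    rw [← Subtype.coe_inj, Commute, SemiconjBy]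
    exact mul_inv_eq_iff_eq_mul
  constructor
  · rintro ⟨a, ha, rfl⟩
    exact ⟨a.2, (key a).1 ha⟩
  · rintro ⟨h1, h2⟩
    exact ⟨⟨a, h1⟩, (key ⟨a, h1⟩).2 h2, rfl⟩

/-- `G` is an `FSZ⁺_n`-group if and only if the elements of `C_G(u, g)` have equally many fixed
points on `G_n(u, g)` and `G_n(u, g ^ m)`. -/
theorem isFSZPlus_iff_ncard_fixedRootSet (n : ℕ) :
    IsFSZPlus n G ↔ ∀ u g : G, Commute u g → ∀ m : ℤ, Int.gcd m (Nat.card G) = 1 →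
      ∀ x : G, Commute x u → Commute x g →
        (fixedRootSet n x u (g ^ m)).ncard = (fixedRootSet n x u g).ncard := by
  refine forall₅_congr fun u g _ m _ => ?_
  constructor
  · rintro ⟨e⟩ x hu hg
    have := congrFun (Representation.char_iso e) ⟨x, mem_centralizer_pair.2 ⟨hu, hg⟩⟩
    rw [character_permRep, character_permRep] at this
    exact_mod_cast this.symm
  · intro h
    refine Representation.nonempty_equiv_of_character_eq (funext fun k => ?_)
    have hk := mem_centralizer_pair.1 k.2
    rw [character_permRep, character_permRep, h k hk.1 hk.2]

/-- An integer coprime to the order of a subgroup is congruent modulo that order to an integer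
coprime to the order of the group. -/
theorem exists_gcd_card_eq_one_and_zpow_eq (H : Subgroup G) {m : ℤ}
    (hm : Int.gcd m (Nat.card H) = 1) :
    ∃ m' : ℤ, Int.gcd m' (Nat.card G) = 1 ∧ ∀ g ∈ H, g ^ m' = g ^ m := by
  have : NeZero (Nat.card G) := ⟨Nat.card_pos.ne'⟩
  have hu : IsUnit (m : ZMod (Nat.card H)) :=
    ZMod.coe_int_isUnit_iff_isCoprime m _ |>.2 (Int.isCoprime_iff_gcd_eq_one.2 hm).symm
  -- Reduction (ℤ/|G|)ˣ → (ℤ/|H|)ˣ is onto, so the class of m lifts to a unit `v`.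
  obtain ⟨v, hv⟩ := ZMod.unitsMap_surjective H.card_subgroup_dvd_card hu.unit
  refine ⟨(v : ZMod (Nat.card G)).val, ?_, fun g hg => ?_⟩
  · rw [Int.gcd_natCast_natCast]
    exact ZMod.val_coe_unit_coprime v
  · have h1 : (((v : ZMod (Nat.card G)).val : ℤ) : ZMod (Nat.card H)) = m := by
      have h2 := congrArg Units.val hv
      rw [ZMod.unitsMap_val, IsUnit.unit_spec] at h2
      rw [← h2, Int.cast_natCast, ZMod.natCast_val]
    rw [ZMod.intCast_eq_intCast_iff] at h1
    have h3 := zpow_mod_natCard (⟨g, hg⟩ : H) (v : ZMod (Nat.card G)).val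
    rw [h1.eq, zpow_mod_natCard] at h3
    exact (congrArg Subtype.val h3).symm

end FixedPoints

end

theorem mainTheorem3 {G : Type*} [Group G] [Finite G] (n : ℕ) (hn : 0 < n) :
    IsFSZPlus n G ↔ ∀ h : G, h ≠ 1 → IsFSZ n (Subgroup.centralizer {h} : Subgroup G) := by
  rw [isFSZPlus_iff_ncard_fixedRootSet]
  constructor
  · intro h x _
    rw [DrinfeldDouble.isFSZ_iff_ncard_rootSet hn]
    intro u g hug m hm
    obtain ⟨m', hm', hpow⟩ := exists_gcd_card_eq_one_and_zpow_eq _ hm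
    have hx : ∀ a : Subgroup.centralizer {x}, Commute x a := fun a =>
      (Subgroup.mem_centralizer_iff.1 a.2) x rfl
    rw [ncard_rootSet_centralizer, ncard_rootSet_centralizer, Subgroup.coe_zpow, ← hpow g g.2]
    exact h u g (congrArg Subtype.val hug) m' hm' x (hx u) (hx g)
  · intro h
    have key : ∀ x u g : G, x ≠ 1 → Commute x u → Commute x g → Commute u g →
        ∀ m : ℤ, Int.gcd m (Nat.card G) = 1 →
          (fixedRootSet n x u (g ^ m)).ncard = (fixedRootSet n x u g).ncard := by
      intro x u g hx hxu hxg hug m hm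
      have hF := (DrinfeldDouble.isFSZ_iff_ncard_rootSet hn).1 (h x hx)
        ⟨u, Subgroup.mem_centralizer_iff.2 (by rintro _ rfl; exact hxu)⟩
        ⟨g, Subgroup.mem_centralizer_iff.2 (by rintro _ rfl; exact hxg)⟩
        (Subtype.ext hug) m (Nat.Coprime.coprime_dvd_right (Subgroup.card_subgroup_dvd_card _) hm)
      rwa [ncard_rootSet_centralizer, ncard_rootSet_centralizer] at hF
    intro u g hug m hm x hxu hxg
    -- The hypothesis says nothing about x = 1; the element g^m takes its place, as it fixes both
    -- root sets pointwise. If g^m = 1, then g = 1 by coprimality and there is nothing to prove.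
    by_cases hx : x = 1
    · subst hx
      by_cases hg : g ^ m = 1
      · have h1 : (orderOf g : ℤ) ∣ m := orderOf_dvd_iff_zpow_eq_one.2 hg
        have h2 : orderOf g ∣ 1 :=
          hm ▸ Int.dvd_gcd h1 (Int.natCast_dvd_natCast.2 (orderOf_dvd_natCard g))
        rw [orderOf_eq_one_iff.1 (Nat.dvd_one.1 h2), one_zpow]
      · rw [fixedRootSet_one, fixedRootSet_one,
          ← fixedRootSet_of_mem_zpowers n u (Subgroup.mem_zpowers (g ^ m)),
          ← fixedRootSet_of_mem_zpowers n u (Subgroup.zpow_mem_zpowers g m)]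
        exact key (g ^ m) u g hg (hug.symm.zpow_left m) ((Commute.refl g).zpow_left m) hug m hm
    · exact key x u g hx hxu hxg hug m hm
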